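/- Let $K$ be a field and $S=K[x_1,\dots,x_n]$ with the standard grading, where $n=d+kt$ with $t\ge 2$, $1\le d\le t$ and $k\ge 3$. A monomial $x_{i_1}\cdots x_{i_e}$ with $i_1\le\dots\le i_e$ is $t$-spread if $i_{j+1}-i_j\ge t$ for all $j$; $M_{n,e,t}$ denotes the set of $t$-spread monomials of degree $e$ in $S$, ordered by the squarefree lexicographic order ($u>v$ if, at the first position where the increasing index sequences of $u$ and $v$ differ, the index of $u$ is smaller). For a monomial $u\neq 1$, $\max(u)$ is the largest $i$ with $x_i\mid u$. An ideal $I$ is $t$-spread strongly stable if it is generated by $t$-spread monomials and, for every $t$-spread monomial $u\in I$, every $x_j\mid u$ and every $i<j$ such that $x_i(u/x_j)$ is $t$-spread, one has $x_i(u/x_j)\in I$. $B_t(u_1,\dots,u_r)$ is the smallest $t$-spread strongly stable ideal containing the $t$-spread monomials $u_1,\dots,u_r$. For a set $T$ of $t$-spread monomials, $\mathrm{Shad}_t(T)$ is the set of $t$-spread monomials of the form $x_iw$ with $w\in T$, and $\mathrm{Shad}_t^m$ is its $m$-fold iterate; inside $\mathrm{Shad}_t^m$, $B_t(u)$ stands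 for its set of minimal monomial generators. A graded Betti number $\beta_{a,a+\ell}(I)=\dim_K\mathrm{Tor}^S_a(K,I)_{a+\ell}\ne 0$ is extremal if $\beta_{i,i+j}(I)=0$ for all $i\ge a$, $j\ge \ell$ with $(i,j)\ne(a,\ell)$; then $(a,\ell)$ is a corner of $I$, in degree $\ell$. $\mathrm{Corn}(I)$ is the set of corners, and $\mathcal S_{t,n,\mathbf 1}$ is the set of $t$-spread strongly stable ideals of $S$ all of whose extremal Betti numbers equal $1$. The initial degree of $I$ is the least degree of a nonzero homogeneous element of $I$. **Theorem.** Let $\ell_1$ be an integer with $3\le \ell_1\le k+\left\lfloor\frac{d-2}{t}\right\rfloor+1$ and put $r=k+\left\lfloor\frac{d-2}{t}\right\rfloor-(\ell_1-2)$, which is a positive integer. 1. Every ideal $I\in\mathcal S_{t,n,\mathbf 1}$ of initial degree $\ell_1$ with a corner in degree $\ell_1$ has at most $r$ corners. 2. The bound is attained. There are $t$-spread monomials $\omega_0,\dots,\omega_{r-1}$ with $\omega_0=x_1x_{1+t}\cdots x_{1+(\ell_1-2)t}\,x_n$ and, for $1\le j\le r-1$, $$\omega_j=\max\Big\{u\in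 M_{n,\ell_1+j,t}\ :\ \max(u)=n,\ u\notin\bigcup_{i=0}^{j-1}\mathrm{Shad}_t^{\,j-i}\big(B_t(\omega_i)\big)\Big\}$$ (in particular these sets are nonempty), and the ideal $I=B_t(\omega_0,\dots,\omega_{r-1})$ belongs to $\mathcal S_{t,n,\mathbf 1}$, has initial degree $\ell_1$, has a corner in degree $\ell_1$, and satisfies $|\mathrm{Corn}(I)|=r$. -/

import Mathlib

open MvPolynomial

noncomputable section

/-! Throughout, `S = K[x_1, …, x_n]` is `MvPolynomial (Fin n) K`, the variable `x_m` of the text being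
`X i` with `i.val + 1 = m`.  For `t ≥ 1` every `t`-spread monomial is squarefree; a squarefree
monomial is represented by its support, a `Finset (Fin n)`. -/

/-- The squarefree monomial of `K[x_1, …, x_n]` with support `A`. -/
def sqfMonomial (K : Type*) [Field K] {n : ℕ} (A : Finset (Fin n)) : MvPolynomial (Fin n) K :=
  ∏ i ∈ A, X i

/-- `max(u)`: the largest (one-based) index of a variable dividing `u`, with `max(1) = 0`. -/
def maxIndex {n : ℕ} (A : Finset (Fin n)) : ℕ :=
  A.sup fun i => i.val + 1

/-- The squarefree monomial with support `A` is `t`-spread (`t ≥ 1`): the indices of any two distinct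
variables dividing it are at least `t` apart. -/
def IsSpread {n : ℕ} (t : ℕ) (A : Finset (Fin n)) : Prop :=
  ∀ i ∈ A, ∀ j ∈ A, i < j → i.val + t ≤ j.val

/-- `M_{n,e,t}`: the `t`-spread monomials of degree `e` in `n` variables. -/
def spreadMonomials (n e t : ℕ) : Set (Finset (Fin n)) :=
  {A | IsSpread t A ∧ A.card = e}

/-- A `t`-spread monomial ideal: an ideal generated by `t`-spread monomials. -/
def IsSpreadIdeal {K : Type*} [Field K] {n : ℕ} (t : ℕ) (I : Ideal (MvPolynomial (Fin n) K)) : Prop :=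
  ∃ G : Set (Finset (Fin n)), (∀ A ∈ G, IsSpread t A) ∧ I = Ideal.span (sqfMonomial K '' G)

/-- `t`-spread strongly stable ideals (`t ≥ 1`): for every `t`-spread monomial `u ∈ I`, all `x_j ∣ u`
and all `i < j` such that `x_i (u / x_j)` is `t`-spread, `x_i (u / x_j) ∈ I`.
(If `x_i ∣ u` then `x_i (u / x_j)` is not squarefree, hence not `t`-spread.) -/
def IsSpreadStronglyStable {K : Type*} [Field K] {n : ℕ} (t : ℕ)
    (I : Ideal (MvPolynomial (Fin n) K)) : Prop :=
  IsSpreadIdeal t I ∧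
    ∀ A : Finset (Fin n), IsSpread t A → sqfMonomial K A ∈ I →
      ∀ j ∈ A, ∀ i < j, i ∉ A → IsSpread t (insert i (A.erase j)) →
        sqfMonomial K (insert i (A.erase j)) ∈ I

/-- The monomials obtained from those in `U` by finitely many moves `u ↦ x_i (u / x_j)`,
`x_j ∣ u`, `i < j`, all of whose results are `t`-spread. For `U = {u}` these are the minimal monomial
generators of `B_t(u)`. -/
inductive SpreadBorel {n : ℕ} (t : ℕ) (U : Set (Finset (Fin n))) : Finset (Fin n) → Prop
  | base (A : Finset (Fin n)) (hA : A ∈ U) : SpreadBorel t U A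
  | move (A : Finset (Fin n)) (i j : Fin n) (hA : SpreadBorel t U A) (hj : j ∈ A) (hij : i < j)
      (hi : i ∉ A) (hs : IsSpread t (insert i (A.erase j))) :
      SpreadBorel t U (insert i (A.erase j))

/-- `B_t(U)`, the ideal with `t`-spread Borel generators `U`. -/
def spreadBorelIdeal (K : Type*) [Field K] {n : ℕ} (t : ℕ) (U : Set (Finset (Fin n))) :
    Ideal (MvPolynomial (Fin n) K) :=
  Ideal.span (sqfMonomial K '' {A | SpreadBorel t U A})

theorem sqfMonomial_eq (K : Type*) [Field K] {n : ℕ} (A : Finset (Fin n)) :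
    sqfMonomial K A = monomial (Finsupp.indicator A fun _ _ => 1) 1 := by
  classical
  rw [sqfMonomial, monomial_eq, Finsupp.prod]
  simp only [map_one, one_mul]
  have hsupp : (Finsupp.indicator A fun _ _ => (1 : ℕ)).support = A := by
    ext i; simp [Finsupp.indicator_apply]
  rw [hsupp]
  refine Finset.prod_congr rfl fun i hi => ?_
  simp [hi]

theorem sqfMonomial_mem_span (K : Type*) [Field K] {n : ℕ} (G : Set (Finset (Fin n)))
    (A : Finset (Fin n)) :
    sqfMonomial K A ∈ Ideal.span (sqfMonomial K '' G) ↔ ∃ B ∈ G, B ⊆ A := by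
  classical
  constructor
  · intro h
    have himg : sqfMonomial K '' G = (fun s => monomial s (1 : K)) ''
        ((fun B : Finset (Fin n) => Finsupp.indicator B fun _ _ => (1 : ℕ)) '' G) := by
      rw [Set.image_image]
      exact Set.image_congr fun B _ => sqfMonomial_eq K B
    rw [himg, mem_ideal_span_monomial_image] at h
    obtain ⟨s, ⟨B, hB, rfl⟩, hle⟩ := h (Finsupp.indicator A fun _ _ => 1) (by
      rw [sqfMonomial_eq, mem_support_iff, coeff_monomial]; simp)
    refine ⟨B, hB, fun i hi => ?_⟩
    have := hle i
    by_contra hiA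
    simp [Finsupp.indicator_apply, hi, hiA] at this
  · rintro ⟨B, hB, hBA⟩
    have hd : sqfMonomial K B ∣ sqfMonomial K A := Finset.prod_dvd_prod_of_subset _ _ _ hBA
    exact Ideal.mem_of_dvd _ hd (Ideal.subset_span ⟨B, hB, rfl⟩)

/-- `B_t(U)` is the smallest `t`-spread strongly stable ideal containing the monomials in `U`. -/
theorem isLeast_spreadBorelIdeal (K : Type*) [Field K] {n : ℕ} (t : ℕ) (U : Set (Finset (Fin n)))
    (hU : ∀ A ∈ U, IsSpread t A) :
    IsLeast {I : Ideal (MvPolynomial (Fin n) K) |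
      IsSpreadStronglyStable t I ∧ ∀ A ∈ U, sqfMonomial K A ∈ I} (spreadBorelIdeal K t U) := by
  classical
  have hsp : ∀ A, SpreadBorel t U A → IsSpread t A := by
    intro A hA
    cases hA with
    | base _ h => exact hU _ h
    | move _ _ _ _ _ _ _ hs => exact hs
  refine ⟨⟨⟨⟨_, hsp, rfl⟩, ?_⟩, ?_⟩, ?_⟩
  · intro A _ hAI j hj i hij hi hs
    obtain ⟨B, hB, hBA⟩ := (sqfMonomial_mem_span K _ A).1 hAI
    refine (sqfMonomial_mem_span K _ _).2 ?_
    by_cases hjB : j ∈ B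
    · have hsub : insert i (B.erase j) ⊆ insert i (A.erase j) :=
        Finset.insert_subset_insert _ (Finset.erase_subset_erase _ hBA)
      exact ⟨_, SpreadBorel.move B i j hB hjB hij (fun h => hi (hBA h))
        (fun a ha b hb => hs a (hsub ha) b (hsub hb)), hsub⟩
    · refine ⟨B, hB, fun b hb => Finset.mem_insert_of_mem (Finset.mem_erase.2 ⟨?_, hBA hb⟩)⟩
      rintro rfl
      exact hjB hb
  · exact fun A hA => Ideal.subset_span ⟨A, SpreadBorel.base A hA, rfl⟩
  · rintro J ⟨⟨_, hJ⟩, hUJ⟩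
    refine Ideal.span_le.2 ?_
    rintro _ ⟨A, hA, rfl⟩
    have hA' : SpreadBorel t U A := hA
    clear hA
    induction hA' with
    | base A h => exact hUJ A h
    | move A i j hA hj hij hi hs ih => exact hJ A (hsp A hA) ih j hj i hij hi hs

/-- `Shad_t(T)`: the `t`-spread monomials of the form `x_i w` with `w ∈ T`. -/
def spreadShadow {n : ℕ} (t : ℕ) (T : Set (Finset (Fin n))) : Set (Finset (Fin n)) :=
  {A | IsSpread t A ∧ ∃ w ∈ T, ∃ i, i ∉ w ∧ A = insert i w}

/-- `u >_slex v` for squarefree monomials `u`, `v` of the same degree: at the first position where the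
increasing sequences of indices differ, the one of `u` is smaller. -/
def SlexGT {n : ℕ} (u v : Finset (Fin n)) : Prop :=
  ∃ i, i ∈ u ∧ i ∉ v ∧ ∀ j < i, (j ∈ u ↔ j ∈ v)

/-- `w` is the largest element of `T` in the squarefree lexicographic order. -/
def IsSlexMax {n : ℕ} (T : Set (Finset (Fin n))) (w : Finset (Fin n)) : Prop :=
  w ∈ T ∧ ∀ v ∈ T, v ≠ w → SlexGT w v

/-- The `t`-spread monomials `u` of degree `e + j` with `max(u) = n` that lie in none of the iterated
shadows `Shad_t^{j - i}(B_t(ω_i))`, `0 ≤ i < j`; here `B_t(ω_i)` stands for its set of minimal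
generators. -/
def newMonomials {n : ℕ} (t e : ℕ) (ω : ℕ → Finset (Fin n)) (j : ℕ) : Set (Finset (Fin n)) :=
  {u | u ∈ spreadMonomials n (e + j) t ∧ maxIndex u = n ∧
    ∀ i < j, u ∉ (spreadShadow t)^[j - i] {A | SpreadBorel t {ω i} A}}

/-- The initial degree of `I` is `e`: the least degree of a nonzero homogeneous element of `I`. -/
def HasInitialDegree {K : Type*} [Field K] {n : ℕ} (I : Ideal (MvPolynomial (Fin n) K)) (e : ℕ) :
    Prop :=
  IsLeast {j : ℕ | ∃ f ∈ I, f ≠ 0 ∧ f.IsHomogeneous j} e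

/-- The differential of the Koszul complex of `x_1, …, x_n`. A function `c` stands for the chain
`∑_A c(A) e_A`, where `e_A = e_{a_1} ∧ ⋯ ∧ e_{a_i}` for `A = {a_1 < ⋯ < a_i}`, and
`∂ e_A = ∑_p (-1)^(p-1) x_{a_p} e_{A ∖ {a_p}}`. -/
def koszulBoundary (K : Type*) [Field K] (n : ℕ) :
    (Finset (Fin n) → MvPolynomial (Fin n) K) →ₗ[K] (Finset (Fin n) → MvPolynomial (Fin n) K) where
  toFun c B := ∑ a ∈ Bᶜ, (-1) ^ (B.filter (· < a)).card * (X a * c (insert a B))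
  map_add' c c' := by
    funext B
    simp [mul_add, Finset.sum_add_distrib]
  map_smul' r c := by
    funext B
    simp [Finset.smul_sum]

/-- The component of internal degree `j` of the `i`-th term of the Koszul complex of `x_1, …, x_n`
with coefficients in `I`; here `e_A` has homological and internal degree `|A|`. -/
def koszulChains {K : Type*} [Field K] {n : ℕ} (I : Ideal (MvPolynomial (Fin n) K)) (i j : ℕ) :
    Submodule K (Finset (Fin n) → MvPolynomial (Fin n) K) where
  carrier := {c | (∀ A, c A ∈ I) ∧ ∀ A m, (c A).coeff m ≠ 0 → A.card = i ∧ m.degree + i = j}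
  add_mem' := by
    rintro c c' ⟨h1, h2⟩ ⟨h1', h2'⟩
    refine ⟨fun A => I.add_mem (h1 A) (h1' A), fun A m hm => ?_⟩
    by_cases h : (c A).coeff m = 0
    · refine h2' A m fun h' => hm ?_
      simp [h, h']
    · exact h2 A m h
  zero_mem' := by simp
  smul_mem' := by
    rintro r c ⟨h1, h2⟩
    refine ⟨fun A => ?_, fun A m hm => h2 A m fun h => hm (by simp [h])⟩
    rw [Pi.smul_apply, smul_eq_C_mul]
    exact I.mul_mem_left _ (h1 A)

/-- The graded Betti number `β_{i,j}(I) = dim_K Tor_i^S(K, I)_j` of a graded ideal `I`, where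
`Tor^S(K, I)` is computed by the Koszul complex of `x_1, …, x_n` (the minimal graded free resolution
of `K` over `S`): degree-`j` cycles modulo degree-`j` boundaries. -/
def gradedBetti {K : Type*} [Field K] {n : ℕ} (I : Ideal (MvPolynomial (Fin n) K)) (i j : ℕ) : ℕ :=
  let Z := koszulChains I i j ⊓ LinearMap.ker (koszulBoundary K n)
  let B := (koszulChains I (i + 1) j).map (koszulBoundary K n)
  Module.finrank K (Z ⧸ B.submoduleOf Z)

/-- The set of corners `(k, ℓ)` of `I`: `β_{k,k+ℓ}(I)` is an extremal Betti number of `I`, that is,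
`β_{k,k+ℓ}(I) ≠ 0` and `β_{i,i+j}(I) = 0` for all `i ≥ k`, `j ≥ ℓ`, `(i,j) ≠ (k,ℓ)`. -/
def corners {K : Type*} [Field K] {n : ℕ} (I : Ideal (MvPolynomial (Fin n) K)) : Set (ℕ × ℕ) :=
  {p | gradedBetti I p.1 (p.1 + p.2) ≠ 0 ∧
    ∀ i j, p.1 ≤ i → p.2 ≤ j → (i, j) ≠ p → gradedBetti I i (i + j) = 0}

/-- The class `𝒮_{t,n,1}` of `t`-spread strongly stable ideals all of whose extremal Betti numbers
are equal to `1`. -/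
def spreadStableOne (K : Type*) [Field K] (n t : ℕ) : Set (Ideal (MvPolynomial (Fin n) K)) :=
  {I | IsSpreadStronglyStable t I ∧ ∀ p ∈ corners I, gradedBetti I p.1 (p.1 + p.2) = 1}

end

/-! Betti numbers are read off from linear quotients. Suppose the minimal generators are ordered by
weakly increasing degree so that, for each generator `u`, the colon ideal of the earlier ones by `u`
is generated by a set `V u` of variables. Adding `u` then adds to Koszul homology a copy of the
exterior algebra on `V u`, shifted by the degree of `u`. Only two consequences are needed. A nonzero
`β_{i,i+j}` forces a generator of degree `j` with `|V u| ≥ i` (`exists_of_gradedBetti_ne_zero`). If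
exactly one generator of degree `j` has `|V u| = i` and all others of that degree have fewer
variables, then `β_{i,i+j} = 1` (`gradedBetti_eq_one`). Spread strongly stable ideals have such an
order (`IsSpreadStronglyStable.hasLinearQuotients`), with `|V u| = max(u) - 1 - t(deg u - 1)`
(`card_colonVariables`).

For the bound, two corners never share a degree, so it suffices to confine their degrees. The
formula for `|V u|` gives degree at most `k + 1`. If `d = 1`, a generator of degree `k + 1` would
have empty `V u`, which is impossible after an earlier generator of degree `ℓ₁`.

For sharpness, write the zero-based indices of a monomial as `p * t + o p`; being `t`-spread means
that the offsets `o` are nondecreasing. Lying in an iterated shadow of `B_t(ω)` becomes a pointwise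
comparison of offsets (`mem_iterate_spreadShadow_spreadBorel`, `Enumerates.dominates_iff`). Hence
`ω_j` is the lexicographically smallest nondecreasing offset sequence with prescribed last entry
that is not pointwise below an earlier `ω_i`; `extremalOffset` is its closed form. In its degree
`ω_j` is the only minimal generator with `max = n`, so it alone attains the largest possible `|V
u|`. That largest value drops strictly as the degree grows, so each `ω_j` gives a corner with Betti
number `1`. -/

/-! ### The Koszul complex: signs, `∂ ∘ ∂ = 0` and contracting homotopies -/

section Koszul

variable {K : Type*} [Field K] {n : ℕ}

/-- The Koszul sign of removing `a` from `insert a B`. -/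
def koszulSign (R : Type*) [Ring R] (a : Fin n) (B : Finset (Fin n)) : R :=
  (-1) ^ (B.filter (· < a)).card

theorem koszulSign_mul_self (R : Type*) [Ring R] (a : Fin n) (B : Finset (Fin n)) :
    koszulSign R a B * koszulSign R a B = 1 := by
  rw [koszulSign, ← pow_add, ← two_mul, pow_mul]; simp

theorem koszulSign_insert_of_lt (R : Type*) [Ring R] {a c : Fin n} (h : a < c)
    (B : Finset (Fin n)) : koszulSign R a (insert c B) = koszulSign R a B := by
  rw [koszulSign, koszulSign, Finset.filter_insert, if_neg (not_lt.2 h.le)]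

theorem koszulSign_insert_of_gt (R : Type*) [Ring R] {a c : Fin n} (h : a < c)
    {B : Finset (Fin n)} (ha : a ∉ B) :
    koszulSign R c (insert a B) = -koszulSign R c B := by
  rw [koszulSign, koszulSign, Finset.filter_insert, if_pos h, Finset.card_insert_of_notMem
    (by simp [ha]), pow_succ]
  simp

theorem koszulSign_swap (R : Type*) [CommRing R] {a c : Fin n} {B : Finset (Fin n)} (hac : a ≠ c)
    (ha : a ∉ B) (hc : c ∉ B) :
    koszulSign R a B * koszulSign R c (insert a B)
      = -(koszulSign R c B * koszulSign R a (insert c B)) := by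
  rcases lt_or_gt_of_ne hac with h | h
  · rw [koszulSign_insert_of_lt R h, koszulSign_insert_of_gt R h ha]; ring
  · rw [koszulSign_insert_of_lt R h, koszulSign_insert_of_gt R h hc]; ring

theorem koszulSign_insert_mul_insert (R : Type*) [CommRing R] {a c : Fin n} {B : Finset (Fin n)}
    (hac : a ≠ c) (ha : a ∉ B) (hc : c ∉ B) :
    koszulSign R a (insert c B) * koszulSign R c (insert a B)
      = -(koszulSign R c B * koszulSign R a B) := by
  rcases lt_or_gt_of_ne hac with h | h
  · rw [koszulSign_insert_of_lt R h, koszulSign_insert_of_gt R h ha]; ring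
  · rw [koszulSign_insert_of_lt R h, koszulSign_insert_of_gt R h hc]; ring

theorem koszulBoundary_apply (c : Finset (Fin n) → MvPolynomial (Fin n) K) (B : Finset (Fin n)) :
    koszulBoundary K n c B = ∑ a ∈ Bᶜ, koszulSign _ a B * (X a * c (insert a B)) := rfl

theorem koszulBoundary_koszulBoundary (c : Finset (Fin n) → MvPolynomial (Fin n) K) :
    koszulBoundary K n (koszulBoundary K n c) = 0 := by
  funext B
  simp only [koszulBoundary_apply, Finset.mul_sum]
  rw [Finset.sum_sigma']
  refine Finset.sum_involution (fun p _ => ⟨p.2, p.1⟩) ?_ ?_ ?_ ?_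
  · rintro ⟨a, b⟩ h
    simp only [Finset.mem_sigma, Finset.mem_compl, Finset.mem_insert, not_or] at h
    obtain ⟨ha, hba, hb⟩ := h
    have := koszulSign_swap (MvPolynomial (Fin n) K) (Ne.symm hba) ha hb
    simp only
    rw [Finset.insert_comm b a]
    linear_combination (X a * X b * c (insert a (insert b B))) * this
  · rintro ⟨a, b⟩ h _ heq
    simp only [Finset.mem_sigma, Finset.mem_compl, Finset.mem_insert, not_or] at h
    simp only [Sigma.mk.injEq, heq_eq_eq] at heq
    exact h.2.1 heq.1
  · rintro ⟨a, b⟩ h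
    simp only [Finset.mem_sigma, Finset.mem_compl, Finset.mem_insert, not_or] at h ⊢
    exact ⟨h.2.2, fun h' => h.2.1 h'.symm, h.1⟩
  · rintro ⟨a, b⟩ h
    rfl

/-- The homotopy `f e_A ↦ ± (f / x_c) e_{A ∪ c}`, where `/ x_c` discards the terms which are not
divisible by `x_c`. -/
noncomputable def koszulHomotopy (c : Fin n) (f : Finset (Fin n) → MvPolynomial (Fin n) K) :
    Finset (Fin n) → MvPolynomial (Fin n) K :=
  fun B => if c ∈ B then
    koszulSign _ c (B.erase c) * (f (B.erase c)).divMonomial (Finsupp.single c 1) else 0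

theorem X_mul_divMonomial_of_ne {a c : Fin n} (h : a ≠ c) (p : MvPolynomial (Fin n) K) :
    (X a * p).divMonomial (Finsupp.single c 1) = X a * p.divMonomial (Finsupp.single c 1) := by
  classical
  ext m
  rw [coeff_divMonomial, coeff_X_mul', coeff_X_mul']
  have h1 : a ∈ (Finsupp.single c 1 + m).support ↔ a ∈ m.support := by
    simp [h.symm]
  by_cases ha : a ∈ m.support
  · rw [if_pos (h1.2 ha), if_pos ha, coeff_divMonomial]
    congr 1
    ext b
    have : 1 ≤ m a := Nat.one_le_iff_ne_zero.2 (Finsupp.mem_support_iff.1 ha)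
    simp only [Finsupp.coe_tsub, Finsupp.coe_add, Pi.sub_apply, Pi.add_apply, Finsupp.single_apply]
    by_cases hab : a = b
    · subst hab; simp [h.symm]
    · simp [hab]
  · rw [if_neg (fun h' => ha (h1.1 h')), if_neg ha]

theorem koszulSign_mul_divMonomial (a c : Fin n) (B : Finset (Fin n))
    (p : MvPolynomial (Fin n) K) :
    (koszulSign _ a B * p).divMonomial (Finsupp.single c 1)
      = koszulSign _ a B * p.divMonomial (Finsupp.single c 1) := by
  rcases neg_one_pow_eq_or (MvPolynomial (Fin n) K) (B.filter (· < a)).card with h | h <;>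
  · rw [koszulSign, h]
    ext m
    simp [coeff_divMonomial]

theorem sum_divMonomial {ι : Type*} (s : Finset ι) (f : ι → MvPolynomial (Fin n) K)
    (m : Fin n →₀ ℕ) : (∑ i ∈ s, f i).divMonomial m = ∑ i ∈ s, (f i).divMonomial m := by
  ext
  simp [coeff_divMonomial, coeff_sum]

/-- The homotopy contracts the Koszul complex in direction `c`: `∂h + h∂` is the identity minus the
projection onto the terms involving neither `e_c` nor `x_c`. -/
theorem koszulBoundary_homotopy_add (c : Fin n) (f : Finset (Fin n) → MvPolynomial (Fin n) K)
    (B : Finset (Fin n)) :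
    koszulBoundary K n (koszulHomotopy c f) B + koszulHomotopy c (koszulBoundary K n f) B
      = f B - if c ∈ B then 0 else (f B).modMonomial (Finsupp.single c 1) := by
  by_cases hc : c ∈ B
  · obtain ⟨B, hcB, rfl⟩ : ∃ B', c ∉ B' ∧ insert c B' = B :=
      ⟨B.erase c, Finset.notMem_erase c B, Finset.insert_erase hc⟩
    have hcompl : Bᶜ = insert c (insert c B)ᶜ := by
      ext x
      simp only [Finset.mem_compl, Finset.mem_insert, not_or]
      by_cases hx : x = c
      · simp [hx, hcB]
      · simp [hx]
    rw [if_pos hc, sub_zero]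
    simp only [koszulHomotopy, hc, if_true]
    rw [Finset.erase_insert hcB, koszulBoundary_apply, koszulBoundary_apply, hcompl,
      Finset.sum_insert (by simp), add_divMonomial, sum_divMonomial, koszulSign_mul_divMonomial,
      X_mul_divMonomial, mul_add, ← mul_assoc, koszulSign_mul_self, one_mul,
      add_left_comm, Finset.mul_sum, ← Finset.sum_add_distrib]
    -- What remains are the directions `a ≠ c`, where the terms of `∂h` and `h∂` cancel because the
    -- two signs are opposite.
    rw [Finset.sum_eq_zero, add_zero]
    intro a ha
    simp only [Finset.mem_compl, Finset.mem_insert, not_or] at ha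
    rw [koszulHomotopy, if_pos (by simp), koszulSign_mul_divMonomial, X_mul_divMonomial_of_ne ha.1,
      Finset.insert_comm a c, Finset.erase_insert (by simp [hcB, Ne.symm ha.1])]
    have := koszulSign_insert_mul_insert (MvPolynomial (Fin n) K) ha.1 ha.2 hcB
    linear_combination (X a * (f (insert a B)).divMonomial (Finsupp.single c 1)) * this
  · rw [if_neg hc]
    have h0 : koszulHomotopy c (koszulBoundary K n f) B = 0 := by simp [koszulHomotopy, hc]
    rw [h0, add_zero, koszulBoundary_apply, Finset.sum_eq_single c]
    · rw [koszulHomotopy, if_pos (by simp), Finset.erase_insert hc]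
      have h1 := koszulSign_mul_self (MvPolynomial (Fin n) K) c B
      have h2 := divMonomial_add_modMonomial_single (f B) c
      linear_combination
        (X c * (f B).divMonomial (Finsupp.single c 1)) * h1 + h2
    · intro a _ hac
      rw [koszulHomotopy, if_neg (by simp [hc, Ne.symm hac])]
      simp
    · intro h
      simp [hc] at h

theorem koszulBoundary_mem_ideal {I : Ideal (MvPolynomial (Fin n) K)}
    {c : Finset (Fin n) → MvPolynomial (Fin n) K} (hc : ∀ A, c A ∈ I) (A : Finset (Fin n)) :
    koszulBoundary K n c A ∈ I := by
  rw [koszulBoundary_apply]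
  exact I.sum_mem fun a _ => I.mul_mem_left _ (I.mul_mem_left _ (hc _))

theorem coeff_koszulSign_mul_ne_zero {a : Fin n} {B : Finset (Fin n)}
    {p : MvPolynomial (Fin n) K} {m : Fin n →₀ ℕ} (h : (koszulSign _ a B * p).coeff m ≠ 0) :
    p.coeff m ≠ 0 := by
  rcases neg_one_pow_eq_or (MvPolynomial (Fin n) K) (B.filter (· < a)).card with h' | h' <;>
  · rw [koszulSign, h'] at h
    simpa using h

theorem koszulBoundary_mem_koszulChains {I : Ideal (MvPolynomial (Fin n) K)} {i j : ℕ}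
    {c : Finset (Fin n) → MvPolynomial (Fin n) K} (hc : c ∈ koszulChains I (i + 1) j) :
    koszulBoundary K n c ∈ koszulChains I i j := by
  classical
  refine ⟨koszulBoundary_mem_ideal hc.1, fun A m hm => ?_⟩
  rw [koszulBoundary_apply, coeff_sum] at hm
  obtain ⟨a, ha, hne⟩ := Finset.exists_ne_zero_of_sum_ne_zero hm
  have h1 := coeff_koszulSign_mul_ne_zero hne
  rw [coeff_X_mul'] at h1
  split_ifs at h1 with h2
  · obtain ⟨h3, h4⟩ := hc.2 _ _ h1
    have haA : a ∉ A := by simpa using ha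
    rw [Finset.card_insert_of_notMem haA] at h3
    refine ⟨by omega, ?_⟩
    have hle : Finsupp.single a 1 ≤ m :=
      Finsupp.single_le_iff.2 (Nat.one_le_iff_ne_zero.2 (Finsupp.mem_support_iff.1 h2))
    have : m.degree = (m - Finsupp.single a 1).degree + 1 := by
      conv_lhs => rw [← tsub_add_cancel_of_le hle]
      rw [map_add, Finsupp.degree_single]
    omega
  · exact absurd rfl h1

theorem koszulHomotopy_mem_koszulChains {i j : ℕ} (c : Fin n)
    {f : Finset (Fin n) → MvPolynomial (Fin n) K} (hf : f ∈ koszulChains ⊤ i j) :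
    koszulHomotopy c f ∈ koszulChains ⊤ (i + 1) j := by
  refine ⟨fun _ => trivial, fun A m hm => ?_⟩
  rw [koszulHomotopy] at hm
  split_ifs at hm with hc
  · have h1 := coeff_koszulSign_mul_ne_zero hm
    rw [coeff_divMonomial] at h1
    obtain ⟨h2, h3⟩ := hf.2 _ _ h1
    rw [map_add, Finsupp.degree_single] at h3
    rw [Finset.card_erase_of_mem hc] at h2
    have := Finset.card_pos.2 ⟨c, hc⟩
    omega
  · simp at hm

/-- Here `f` is a cycle modulo the ideal generated by `V`. Applying the homotopies for the variables
of `W` one at a time pushes it, modulo that ideal and boundaries, onto terms free of `W`. With `W =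
Vᶜ` only constants on subsets of `V` survive: the Koszul homology of `S/(V)`. -/
theorem exists_reduction_mod_variables (V W : Finset (Fin n)) (hVW : Disjoint V W) {i j : ℕ}
    {f : Finset (Fin n) → MvPolynomial (Fin n) K} (hf : f ∈ koszulChains ⊤ i j)
    (hbd : ∀ B m, (koszulBoundary K n f B).coeff m ≠ 0 → ∃ v ∈ V, m v ≠ 0) :
    ∃ g ∈ koszulChains (⊤ : Ideal (MvPolynomial (Fin n) K)) (i + 1) j, ∀ A m,
      (f A - koszulBoundary K n g A).coeff m ≠ 0 →
        (∃ v ∈ V, m v ≠ 0) ∨ ∀ c ∈ W, c ∉ A ∧ m c = 0 := by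
  classical
  induction W using Finset.induction_on with
  | empty => exact ⟨0, Submodule.zero_mem _, fun A m _ => Or.inr (by simp)⟩
  | insert c W hc ih =>
    rw [Finset.disjoint_insert_right] at hVW
    obtain ⟨g, hg, hfg⟩ := ih hVW.2
    set f' := f - koszulBoundary K n g with hf'
    have hf'mem : f' ∈ koszulChains ⊤ i j :=
      Submodule.sub_mem _ hf (koszulBoundary_mem_koszulChains hg)
    have hbd' : koszulBoundary K n f' = koszulBoundary K n f := by
      rw [hf', map_sub, koszulBoundary_koszulBoundary, sub_zero]
    refine ⟨g + koszulHomotopy c f',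
      Submodule.add_mem _ hg (koszulHomotopy_mem_koszulChains c hf'mem), fun A m hm => ?_⟩
    have key := koszulBoundary_homotopy_add c f' A
    have hsplit : f A - koszulBoundary K n (g + koszulHomotopy c f') A
        = koszulHomotopy c (koszulBoundary K n f) A
          + if c ∈ A then 0 else (f' A).modMonomial (Finsupp.single c 1) := by
      rw [hbd'] at key
      have h1 : f' A = f A - koszulBoundary K n g A := rfl
      rw [map_add, Pi.add_apply]
      linear_combination (-1 : MvPolynomial (Fin n) K) * key - h1
    rw [hsplit, coeff_add] at hm
    by_cases h0 : (koszulHomotopy c (koszulBoundary K n f) A).coeff m = 0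
    · rw [h0, zero_add] at hm
      split_ifs at hm with hcA
      · simp at hm
      · by_cases hmc : Finsupp.single c 1 ≤ m
        · rw [coeff_modMonomial_of_le _ hmc] at hm
          exact absurd rfl hm
        · rw [coeff_modMonomial_of_not_le _ hmc] at hm
          refine (hfg A m hm).imp_right fun h x hx => ?_
          rcases Finset.mem_insert.1 hx with rfl | hx
          · rw [Finsupp.single_le_iff] at hmc
            exact ⟨hcA, by omega⟩
          · exact h x hx
    -- The term `h(∂f)` stays in the ideal generated by `V`, since `c ∉ V` and dividing by `x_c`
    -- removes no variable of `V`.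
    · left
      rw [koszulHomotopy] at h0
      split_ifs at h0 with hcA
      · have h1 := coeff_koszulSign_mul_ne_zero h0
        rw [coeff_divMonomial] at h1
        obtain ⟨v, hv, hne⟩ := hbd _ _ h1
        refine ⟨v, hv, ?_⟩
        have : c ≠ v := fun h => hVW.1 (h ▸ hv)
        simpa [Finsupp.single_apply, this] using hne
      · simp at h0

end Koszul

/-! ### Betti numbers of squarefree monomial ideals with linear quotients -/

section LinearQuotients

variable {K : Type*} [Field K] {n : ℕ}

theorem mem_span_sqfMonomial_iff {G : Set (Finset (Fin n))} {p : MvPolynomial (Fin n) K} :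
    p ∈ Ideal.span (sqfMonomial K '' G) ↔
      ∀ m, p.coeff m ≠ 0 → ∃ B ∈ G, ∀ i ∈ B, m i ≠ 0 := by
  classical
  have himg : sqfMonomial K '' G = (fun s => monomial s (1 : K)) ''
      ((fun B : Finset (Fin n) => Finsupp.indicator B fun _ _ => (1 : ℕ)) '' G) := by
    rw [Set.image_image]
    exact Set.image_congr fun B _ => sqfMonomial_eq K B
  rw [himg, mem_ideal_span_monomial_image]
  simp only [mem_support_iff, Set.exists_mem_image]
  refine forall₂_congr fun m _ => exists_congr fun B => and_congr_right fun _ => ?_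
  constructor
  · intro h i hi
    have := h i
    simp only [Finsupp.indicator_apply, hi, dif_pos] at this
    omega
  · intro h i
    by_cases hi : i ∈ B
    · simpa [Finsupp.indicator_apply, hi] using Nat.one_le_iff_ne_zero.2 (h i hi)
    · simp [Finsupp.indicator_apply, hi]

theorem indicator_one_degree (u : Finset (Fin n)) :
    (Finsupp.indicator u fun _ _ => (1 : ℕ)).degree = u.card := by
  classical
  rw [Finsupp.degree_eq_sum]
  simp [Finsupp.indicator_apply]

theorem sqfMonomial_mul_coeff (u : Finset (Fin n)) (p : MvPolynomial (Fin n) K) (m : Fin n →₀ ℕ) :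
    (sqfMonomial K u * p).coeff ((Finsupp.indicator u fun _ _ => 1) + m) = p.coeff m := by
  rw [sqfMonomial_eq, coeff_monomial_mul, one_mul]

theorem sqfMonomial_mul_coeff_ne_zero {u : Finset (Fin n)} {p : MvPolynomial (Fin n) K}
    {m : Fin n →₀ ℕ} (h : (sqfMonomial K u * p).coeff m ≠ 0) :
    ∃ m', m = (Finsupp.indicator u fun _ _ => 1) + m' ∧ p.coeff m' ≠ 0 := by
  classical
  rw [sqfMonomial_eq, coeff_monomial_mul', one_mul] at h
  split_ifs at h with hle
  · exact ⟨_, (add_tsub_cancel_of_le hle).symm, h⟩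
  · exact absurd rfl h

/-- One step of the mapping cone, with `J` spanned by `s`. Modulo `J` the chain is `u` times a chain
`f`. The boundary of `f` has coefficients in `J : u = (V)`, so `f` reduces to constants `μ A` on
subsets of `V`. -/
theorem exists_koszul_reduction {s : Set (Finset (Fin n))} {u V : Finset (Fin n)}
    (hdisj : Disjoint V u) (hmeets : ∀ B ∈ s, ∃ v ∈ V, v ∈ B)
    (hcovers : ∀ v ∈ V, ∃ B ∈ s, B ⊆ insert v u) {i j : ℕ}
    {c : Finset (Fin n) → MvPolynomial (Fin n) K}
    (hc : c ∈ koszulChains (Ideal.span (sqfMonomial K '' insert u s)) i j)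
    (hbd : ∀ B, koszulBoundary K n c B ∈ Ideal.span (sqfMonomial K '' s)) :
    ∃ b ∈ koszulChains (Ideal.span (sqfMonomial K '' insert u s)) (i + 1) j,
      ∃ μ : Finset (Fin n) → K, (∀ A, μ A ≠ 0 → A ⊆ V ∧ A.card = i ∧ u.card + i = j) ∧
        ∀ A, c A - koszulBoundary K n b A - C (μ A) * sqfMonomial K u ∈
          Ideal.span (sqfMonomial K '' s) := by
  classical
  set J := Ideal.span (sqfMonomial K '' s) with hJ
  set e : Fin n →₀ ℕ := Finsupp.indicator u fun _ _ => 1 with he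
  have he_apply : ∀ x, e x = if x ∈ u then 1 else 0 := fun x => by
    rw [he, Finsupp.indicator_apply]; simp
  have hue : sqfMonomial K u = monomial e 1 := sqfMonomial_eq K u
  -- `u` times a monomial lies in `J` iff the monomial involves a variable in `V`
  have hcolon : ∀ p : MvPolynomial (Fin n) K, sqfMonomial K u * p ∈ J ↔
      ∀ m, p.coeff m ≠ 0 → ∃ v ∈ V, m v ≠ 0 := by
    intro p
    rw [hJ, mem_span_sqfMonomial_iff]
    constructor
    · intro h m hm
      obtain ⟨B, hB, hBm⟩ := h (e + m) (by rwa [sqfMonomial_mul_coeff])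
      obtain ⟨v, hv, hvB⟩ := hmeets B hB
      refine ⟨v, hv, ?_⟩
      have := hBm v hvB
      rw [Finsupp.add_apply, he_apply, if_neg (Finset.disjoint_left.1 hdisj hv), zero_add] at this
      exact this
    · intro h m hm
      obtain ⟨m', rfl, hm'⟩ := sqfMonomial_mul_coeff_ne_zero hm
      obtain ⟨v, hv, hvm⟩ := h m' hm'
      obtain ⟨B, hB, hBu⟩ := hcovers v hv
      refine ⟨B, hB, fun i hi => ?_⟩
      rw [← he, Finsupp.add_apply, he_apply]
      rcases Finset.mem_insert.1 (hBu hi) with rfl | hiu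
      · omega
      · simp [hiu]
  set f : Finset (Fin n) → MvPolynomial (Fin n) K := fun A => (c A).divMonomial e with hf
  have hdec : ∀ A, c A - sqfMonomial K u * f A ∈ J := by
    intro A
    have h1 : c A - sqfMonomial K u * f A = (c A).modMonomial e := by
      rw [hue, sub_eq_iff_eq_add, add_comm]
      exact (divMonomial_add_modMonomial _ _).symm
    rw [h1, hJ, mem_span_sqfMonomial_iff]
    intro m hm
    by_cases hle : e ≤ m
    · rw [coeff_modMonomial_of_le _ hle] at hm
      exact absurd rfl hm
    rw [coeff_modMonomial_of_not_le _ hle] at hm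
    obtain ⟨B, hB, hBm⟩ := mem_span_sqfMonomial_iff.1 (hc.1 A) m hm
    rcases hB with rfl | hB
    · refine absurd (fun x => ?_) hle
      rw [he_apply]
      split_ifs with hx
      · exact Nat.one_le_iff_ne_zero.2 (hBm x hx)
      · exact Nat.zero_le _
    · exact ⟨B, hB, hBm⟩
  have hbdf : ∀ B, sqfMonomial K u * koszulBoundary K n f B ∈ J := by
    intro B
    have h1 := koszulBoundary_mem_ideal (c := fun A => c A - sqfMonomial K u * f A) hdec B
    have h2 : koszulBoundary K n (fun A => c A - sqfMonomial K u * f A) B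
        = koszulBoundary K n c B - sqfMonomial K u * koszulBoundary K n f B := by
      simp only [koszulBoundary_apply, Finset.mul_sum, ← Finset.sum_sub_distrib]
      exact Finset.sum_congr rfl fun a _ => by ring
    rw [h2] at h1
    simpa using J.sub_mem (hbd B) h1
  -- In lower internal degree no term of `c` is divisible by `u`, so `f = 0` and nothing has to be
  -- reduced.
  by_cases hj : u.card + i ≤ j
  swap
  · refine ⟨0, Submodule.zero_mem _, 0, fun A h => absurd rfl h, fun A => ?_⟩
    have hf0 : f A = 0 := by
      ext m
      rw [hf, coeff_divMonomial, coeff_zero]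
      by_contra hne
      have := (hc.2 _ _ hne).2
      rw [map_add, he, indicator_one_degree] at this
      omega
    have := hdec A
    rw [hf0, mul_zero] at this
    simpa using this
  obtain ⟨j', rfl⟩ := Nat.exists_eq_add_of_le hj
  have hfmem : f ∈ koszulChains (⊤ : Ideal (MvPolynomial (Fin n) K)) i (i + j') := by
    refine ⟨fun _ => trivial, fun A m hm => ?_⟩
    rw [hf, coeff_divMonomial] at hm
    obtain ⟨h1, h2⟩ := hc.2 _ _ hm
    rw [map_add, he, indicator_one_degree] at h2
    exact ⟨h1, by omega⟩
  obtain ⟨g, hg, hfg⟩ := exists_reduction_mod_variables V Vᶜ disjoint_compl_right hfmem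
    (fun B => (hcolon _).1 (hbdf B))
  -- The coefficients of `f` are homogeneous of degree `j'`, so a constant term can survive only for
  -- `j' = 0`; this is what pins `μ` to the internal degree `u.card + i`.
  refine ⟨fun A => sqfMonomial K u * g A, ⟨fun A => ?_, fun A m hm => ?_⟩,
    fun A => if A ⊆ V ∧ A.card = i ∧ j' = 0 then (f A - koszulBoundary K n g A).coeff 0 else 0,
    fun A hA => ?_, fun A => ?_⟩
  · exact Ideal.mul_mem_right _ _ (Ideal.subset_span ⟨u, Set.mem_insert _ _, rfl⟩)
  · obtain ⟨m', rfl, hm'⟩ := sqfMonomial_mul_coeff_ne_zero hm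
    obtain ⟨h1, h2⟩ := hg.2 _ _ hm'
    rw [map_add, indicator_one_degree]
    exact ⟨h1, by omega⟩
  · dsimp only at hA
    split_ifs at hA with h
    · exact ⟨h.1, h.2.1, by omega⟩
    · exact absurd rfl hA
  · have h2 : koszulBoundary K n (fun A => sqfMonomial K u * g A) A
        = sqfMonomial K u * koszulBoundary K n g A := by
      simp only [koszulBoundary_apply, Finset.mul_sum]
      exact Finset.sum_congr rfl fun a _ => by ring
    set μ := if A ⊆ V ∧ A.card = i ∧ j' = 0 then
      (f A - koszulBoundary K n g A).coeff 0 else 0 with hμ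
    have h3 : c A - koszulBoundary K n (fun A => sqfMonomial K u * g A) A
          - C μ * sqfMonomial K u
        = (c A - sqfMonomial K u * f A)
          + sqfMonomial K u * (f A - koszulBoundary K n g A - C μ) := by
      rw [h2]; ring
    rw [h3]
    refine J.add_mem (hdec A) ((hcolon _).2 fun m hm => ?_)
    have hmem : f - koszulBoundary K n g ∈ koszulChains (⊤ : Ideal _) i (i + j') :=
      Submodule.sub_mem _ hfmem (koszulBoundary_mem_koszulChains hg)
    by_cases hm0 : m = 0
    · subst hm0
      exfalso
      apply hm
      rw [coeff_sub, coeff_C, if_pos rfl, sub_eq_zero, hμ]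
      split_ifs with h
      · rfl
      · by_contra hne
        apply h
        obtain ⟨h4, h5⟩ := hmem.2 A 0 hne
        rcases hfg A 0 hne with ⟨v, _, hv⟩ | h'
        · exact absurd rfl hv
        · refine ⟨fun x hx => ?_, h4, ?_⟩
          · by_contra hxV
            exact (h' x (by simpa using hxV)).1 hx
          · rw [map_zero] at h5; omega
    · have hne : (f A - koszulBoundary K n g A).coeff m ≠ 0 := by
        rw [coeff_sub, coeff_C, if_neg (Ne.symm hm0), sub_zero] at hm
        exact hm
      rcases hfg A m hne with h' | h'
      · exact h'
      · obtain ⟨x, hx⟩ := Finsupp.ne_iff.1 hm0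
        refine ⟨x, ?_, hx⟩
        by_contra hxV
        exact hx (h' x (by simpa using hxV)).2

/-- The ideal generated by the squarefree monomials in `G` has linear quotients with respect to the
order of increasing `key`: the colon ideal at `u` is generated by the variables in `V u`. The degrees
increase with `key`. -/
structure HasLinearQuotients {α : Type*} [LinearOrder α] (G : Finset (Finset (Fin n)))
    (key : Finset (Fin n) → α) (V : Finset (Fin n) → Finset (Fin n)) : Prop where
  disj : ∀ u ∈ G, Disjoint (V u) u
  meets : ∀ u ∈ G, ∀ w ∈ G, w ≠ u → key w ≤ key u → ∃ x ∈ V u, x ∈ w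
  covers : ∀ u ∈ G, ∀ x ∈ V u, ∃ w ∈ G, key w < key u ∧ w ⊆ insert x u
  card_le : ∀ u ∈ G, ∀ w ∈ G, key w ≤ key u → w.card ≤ u.card

namespace HasLinearQuotients

variable {α : Type*} [LinearOrder α] {G : Finset (Finset (Fin n))}
  {key : Finset (Fin n) → α} {V : Finset (Fin n) → Finset (Fin n)}

theorem of_insert {a : Finset (Fin n)} (h : HasLinearQuotients (insert a G) key V)
    (hmax : ∀ u ∈ G, key u ≤ key a) : HasLinearQuotients G key V where
  disj u hu := h.disj u (Finset.mem_insert_of_mem hu)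
  meets u hu w hw := h.meets u (Finset.mem_insert_of_mem hu) w (Finset.mem_insert_of_mem hw)
  covers u hu x hx := by
    obtain ⟨w, hw, hlt, hsub⟩ := h.covers u (Finset.mem_insert_of_mem hu) x hx
    rcases Finset.mem_insert.1 hw with rfl | hw
    · exact absurd (hmax u hu) (not_le.2 hlt)
    · exact ⟨w, hw, hlt, hsub⟩
  card_le u hu w hw := h.card_le u (Finset.mem_insert_of_mem hu) w (Finset.mem_insert_of_mem hw)

/-- Linear quotients make `G` a minimal generating set: an earlier `w` contains a variable of `V u`,
hence one outside `u`, while a later one has at least the degree of `u`. -/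
theorem not_subset (h : HasLinearQuotients G key V) {u w : Finset (Fin n)} (hu : u ∈ G)
    (hw : w ∈ G) (hne : w ≠ u) : ¬ w ⊆ u := by
  intro hsub
  rcases le_total (key w) (key u) with hk | hk
  · obtain ⟨x, hx, hxw⟩ := h.meets u hu w hw hne hk
    exact Finset.disjoint_left.1 (h.disj u hu) hx (hsub hxw)
  · exact hne (Finset.eq_of_subset_of_card_le hsub (h.card_le w hw u hu hk))

theorem reduction {a : Finset (Fin n)} (h : HasLinearQuotients (insert a G) key V) (ha : a ∉ G)
    (hmax : ∀ u ∈ G, key u ≤ key a) {i j : ℕ} {c : Finset (Fin n) → MvPolynomial (Fin n) K}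
    (hc : c ∈ koszulChains (Ideal.span (sqfMonomial K '' (insert a G : Finset _))) i j)
    (hbd : koszulBoundary K n c = 0) :
    ∃ b ∈ koszulChains (Ideal.span (sqfMonomial K '' (insert a G : Finset _))) (i + 1) j,
      ∃ μ : Finset (Fin n) → K, (∀ A, μ A ≠ 0 → A ⊆ V a ∧ A.card = i ∧ a.card + i = j) ∧
        ∀ A, c A - koszulBoundary K n b A - C (μ A) * sqfMonomial K a ∈
          Ideal.span (sqfMonomial K '' (G : Set (Finset (Fin n)))) := by
  rw [Finset.coe_insert] at hc ⊢
  refine exists_koszul_reduction (h.disj a (Finset.mem_insert_self _ _)) (fun B hB => ?_)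
    (fun v hv => ?_) hc (fun B => by rw [hbd]; exact Ideal.zero_mem _)
  · refine h.meets a (Finset.mem_insert_self _ _) B (Finset.mem_insert_of_mem hB) ?_ (hmax B hB)
    rintro rfl
    exact ha hB
  · obtain ⟨w, hw, hlt, hsub⟩ := h.covers a (Finset.mem_insert_self _ _) v hv
    rcases Finset.mem_insert.1 hw with rfl | hw
    · exact absurd hlt (lt_irrefl _)
    · exact ⟨w, hw, hsub⟩

theorem span_mono_insert (a : Finset (Fin n)) :
    Ideal.span (sqfMonomial K '' (G : Set (Finset (Fin n)))) ≤
      Ideal.span (sqfMonomial K '' (insert a G : Finset _)) :=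
  Ideal.span_mono (Set.image_mono (by simp))

theorem _root_.koszulChains_mono {I J : Ideal (MvPolynomial (Fin n) K)} (h : I ≤ J) (i j : ℕ) :
    koszulChains I i j ≤ koszulChains J i j :=
  fun _ hc => ⟨fun A => h (hc.1 A), hc.2⟩

/-- Peeling off the last generator leaves only constants on `i`-element subsets of its colon
variables. When there are too few variables these vanish, and the cycle descends to the ideal of the
earlier generators. -/
theorem exists_boundary_eq (h : HasLinearQuotients G key V) {i j : ℕ}
    (hG : ∀ u ∈ G, u.card + i = j → (V u).card < i)
    {c : Finset (Fin n) → MvPolynomial (Fin n) K}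
    (hc : c ∈ koszulChains (Ideal.span (sqfMonomial K '' (G : Set (Finset (Fin n))))) i j)
    (hbd : koszulBoundary K n c = 0) :
    ∃ b ∈ koszulChains (Ideal.span (sqfMonomial K '' (G : Set (Finset (Fin n))))) (i + 1) j,
      koszulBoundary K n b = c := by
  classical
  induction G using Finset.induction_on_max_value key generalizing c with
  | empty =>
    refine ⟨0, Submodule.zero_mem _, ?_⟩
    rw [map_zero]
    funext A
    have := hc.1 A
    simpa [eq_comm] using this
  | insert a G ha hmax ih =>
    obtain ⟨b, hb, μ, hμ, hred⟩ := h.reduction ha hmax hc hbd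
    have hμ0 : ∀ A, μ A = 0 := by
      intro A
      by_contra hne
      obtain ⟨h1, h2, h3⟩ := hμ A hne
      have h4 := hG a (Finset.mem_insert_self _ _) h3
      have h5 := Finset.card_le_card h1
      omega
    have hc' : c - koszulBoundary K n b ∈
        koszulChains (Ideal.span (sqfMonomial K '' (G : Set (Finset (Fin n))))) i j := by
      refine ⟨fun A => ?_, ?_⟩
      · have := hred A
        rw [hμ0] at this
        simpa using this
      · exact (Submodule.sub_mem _ hc (koszulBoundary_mem_koszulChains hb)).2
    obtain ⟨b', hb', hbb'⟩ := ih (h.of_insert hmax)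
      (fun u hu => hG u (Finset.mem_insert_of_mem hu)) hc'
      (by rw [map_sub, hbd, koszulBoundary_koszulBoundary, sub_zero])
    refine ⟨b + b', Submodule.add_mem _ hb (koszulChains_mono (span_mono_insert a) _ _ hb'), ?_⟩
    rw [map_add, hbb']
    abel

theorem _root_.single_mem_koszulChains {I : Ideal (MvPolynomial (Fin n) K)} {a A : Finset (Fin n)}
    (ha : sqfMonomial K a ∈ I) {i j : ℕ} (hA : A.card = i) (hj : a.card + i = j) :
    (Pi.single A (sqfMonomial K a) : Finset (Fin n) → MvPolynomial (Fin n) K) ∈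
      koszulChains I i j := by
  classical
  refine ⟨fun B => ?_, fun B m hm => ?_⟩
  · by_cases hB : B = A
    · subst hB
      rwa [Pi.single_eq_same]
    · rw [Pi.single_eq_of_ne hB]
      exact Ideal.zero_mem _
  · by_cases hB : B = A
    · subst hB
      rw [Pi.single_eq_same, sqfMonomial_eq, coeff_monomial] at hm
      split_ifs at hm with h1
      · rw [← h1, indicator_one_degree]
        exact ⟨hA, hj⟩
      · exact absurd rfl hm
    · rw [Pi.single_eq_of_ne hB] at hm
      simp at hm

/-- Lifts the class `a · e_{V a}` to a cycle: its boundary has coefficients in the ideal of the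
earlier generators because `x a` lies there for `x ∈ V a`, and that boundary is already a boundary
there. -/
theorem exists_correction {a : Finset (Fin n)} (h : HasLinearQuotients (insert a G) key V)
    (hmax : ∀ u ∈ G, key u ≤ key a) {i j : ℕ} (hj : a.card + i = j) (hV : (V a).card = i) :
    ∃ y ∈ koszulChains (Ideal.span (sqfMonomial K '' (G : Set (Finset (Fin n))))) i j,
      koszulBoundary K n y = koszulBoundary K n (Pi.single (V a) (sqfMonomial K a)) := by
  classical
  have hJ : ∀ B, koszulBoundary K n (Pi.single (V a) (sqfMonomial K a)) B ∈
      Ideal.span (sqfMonomial K '' (G : Set (Finset (Fin n)))) := by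
    intro B
    rw [koszulBoundary_apply]
    refine Ideal.sum_mem _ fun x hx => Ideal.mul_mem_left _ _ ?_
    by_cases hxV : insert x B = V a
    · rw [hxV, Pi.single_eq_same]
      obtain ⟨w, hw, hlt, hsub⟩ := h.covers a (Finset.mem_insert_self _ _) x
        (hxV ▸ Finset.mem_insert_self x B)
      have hwG : w ∈ G := by
        rcases Finset.mem_insert.1 hw with rfl | hw
        · exact absurd hlt (lt_irrefl _)
        · exact hw
      have hxa : x ∉ a := Finset.disjoint_left.1 (h.disj a (Finset.mem_insert_self _ _))
        (hxV ▸ Finset.mem_insert_self x B)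
      have : X x * sqfMonomial K a = sqfMonomial K (insert x a) := by
        rw [sqfMonomial, sqfMonomial, Finset.prod_insert hxa]
      rw [this, sqfMonomial_mem_span]
      exact ⟨w, hwG, hsub⟩
    · rw [Pi.single_eq_of_ne hxV, mul_zero]
      exact Ideal.zero_mem _
  rcases i with _ | i
  · refine ⟨0, Submodule.zero_mem _, ?_⟩
    rw [map_zero]
    funext B
    rw [koszulBoundary_apply]
    refine (Finset.sum_eq_zero fun x _ => ?_).symm
    rw [Pi.single_eq_of_ne, mul_zero, mul_zero]
    intro hx
    rw [← hx] at hV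
    simp at hV
  -- In homological degree one lower, a class of the same internal degree would need a generator of
  -- degree `a.card + 1`, but the earlier generators have degree at most `a.card`.
  · refine (h.of_insert hmax).exists_boundary_eq (i := i) (j := j) (fun w hw hwj => ?_) ⟨hJ, ?_⟩
      (koszulBoundary_koszulBoundary _)
    · have := h.card_le a (Finset.mem_insert_self _ _) w (Finset.mem_insert_of_mem hw) (hmax w hw)
      omega
    · exact (koszulBoundary_mem_koszulChains
        (single_mem_koszulChains (I := ⊤) trivial hV hj)).2

/-- The cycle comes from the top exterior power of `V u`, the only class of this bidegree. The
normalised coefficient is recorded because it certifies later that the cycle is not a boundary. -/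
theorem exists_generating_cycle (h : HasLinearQuotients G key V) {i j : ℕ}
    {u : Finset (Fin n)} (hu : u ∈ G) (hj : u.card + i = j) (hV : (V u).card = i)
    (hG : ∀ w ∈ G, w ≠ u → w.card + i = j → (V w).card < i) :
    ∃ z ∈ koszulChains (Ideal.span (sqfMonomial K '' (G : Set (Finset (Fin n))))) i j,
      koszulBoundary K n z = 0 ∧
      (z (V u)).coeff (Finsupp.indicator u fun _ _ => 1) = 1 ∧
      ∀ c ∈ koszulChains (Ideal.span (sqfMonomial K '' (G : Set (Finset (Fin n))))) i j,
        koszulBoundary K n c = 0 → ∃ μ : K,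
        ∃ b ∈ koszulChains (Ideal.span (sqfMonomial K '' (G : Set (Finset (Fin n))))) (i + 1) j,
          c - μ • z = koszulBoundary K n b := by
  classical
  induction G using Finset.induction_on_max_value key with
  | empty => simp at hu
  | insert a G ha hmax ih =>
    have hG' : ∀ w ∈ G, w ≠ u → w.card + i = j → (V w).card < i :=
      fun w hw => hG w (Finset.mem_insert_of_mem hw)
    have hLQ := h.of_insert hmax
    rcases eq_or_ne a u with rfl | hau
    · -- the generator under consideration is the last one
      have hGne : ∀ w ∈ G, w ≠ a := fun w hw hwa => ha (hwa ▸ hw)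
      obtain ⟨y, hy, hyb⟩ := h.exists_correction (K := K) hmax hj hV
      obtain ⟨z, hzdef⟩ : ∃ z : Finset (Fin n) → MvPolynomial (Fin n) K,
          z = Pi.single (V a) (sqfMonomial K a) - y := ⟨_, rfl⟩
      have hzV : z (V a) = sqfMonomial K a - y (V a) := by
        rw [hzdef, Pi.sub_apply, Pi.single_eq_same]
      have hzne : ∀ A, A ≠ V a → z A = -y A := by
        intro A hA
        rw [hzdef, Pi.sub_apply, Pi.single_eq_of_ne hA, zero_sub]
      have hzmem : z ∈ koszulChains (Ideal.span (sqfMonomial K '' (insert a G : Finset _))) i j := by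
        rw [hzdef]
        exact Submodule.sub_mem _
          (single_mem_koszulChains (Ideal.subset_span (Set.mem_image_of_mem _ (by simp))) hV hj)
          (koszulChains_mono (span_mono_insert a) _ _ hy)
      have hzb : koszulBoundary K n z = 0 := by
        rw [hzdef, map_sub, hyb, sub_self]
      refine ⟨z, hzmem, hzb, ?_, ?_⟩
      · have hy0 : (y (V a)).coeff (Finsupp.indicator a fun _ _ => 1) = 0 := by
          by_contra hne
          obtain ⟨B, hB, hBm⟩ := mem_span_sqfMonomial_iff.1 (hy.1 (V a)) _ hne
          refine h.not_subset (Finset.mem_insert_self a G) (Finset.mem_insert_of_mem hB)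
            (hGne B hB) fun x hx => ?_
          by_contra hxa
          exact hBm x hx (by simp [Finsupp.indicator_apply, hxa])
        rw [hzV, coeff_sub, hy0, sub_zero, sqfMonomial_eq,
          coeff_monomial, if_pos rfl]
      · intro c hc hbd
        obtain ⟨b, hb, μ, hμ, hred⟩ := h.reduction ha hmax hc hbd
        have hμV : ∀ A, A ≠ V a → μ A = 0 := by
          intro A hA
          by_contra hne
          obtain ⟨h1, h2, h3⟩ := hμ A hne
          -- A subset of `V a` with `i = |V a|` elements is `V a` itself, so a single scalar
          -- survives.
          exact hA (Finset.eq_of_subset_of_card_le h1 (by omega))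
        set c' := c - koszulBoundary K n b - μ (V a) • z with hc'
        have hc'mem : c' ∈
            koszulChains (Ideal.span (sqfMonomial K '' (G : Set (Finset (Fin n))))) i j := by
          refine ⟨fun A => ?_, (Submodule.sub_mem _ (Submodule.sub_mem _ hc
            (koszulBoundary_mem_koszulChains hb)) (Submodule.smul_mem _ _ hzmem)).2⟩
          have h1 := hred A
          have h2 : c' A = (c A - koszulBoundary K n b A - C (μ A) * sqfMonomial K a)
              + C (μ (V a)) * y A := by
            rw [hc']
            simp only [Pi.sub_apply, Pi.smul_apply, smul_eq_C_mul]
            by_cases hA : A = V a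
            · subst hA
              rw [hzV]; ring
            · rw [hzne A hA, hμV A hA, C_0]; ring
          rw [h2]
          exact Ideal.add_mem _ h1 (Ideal.mul_mem_left _ _ (hy.1 A))
        have hc'b : koszulBoundary K n c' = 0 := by
          rw [hc', map_sub, map_sub, map_smul, hbd, hzb, koszulBoundary_koszulBoundary, smul_zero,
            sub_zero, sub_zero]
        obtain ⟨b', hb', hbb'⟩ := hLQ.exists_boundary_eq
          (fun w hw => hG' w hw (hGne w hw)) hc'mem
          hc'b
        refine ⟨μ (V a), b + b',
          Submodule.add_mem _ hb (koszulChains_mono (span_mono_insert a) _ _ hb'), ?_⟩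
        rw [map_add, hbb', hc']
        abel
    · obtain ⟨z, hz, hzb, hz1, hgen⟩ := ih hLQ
        ((Finset.mem_insert.1 hu).resolve_left (Ne.symm hau)) hG'
      refine ⟨z, koszulChains_mono (span_mono_insert a) _ _ hz, hzb, hz1, fun c hc hbd => ?_⟩
      obtain ⟨b, hb, μ, hμ, hred⟩ := h.reduction ha hmax hc hbd
      have hμ0 : ∀ A, μ A = 0 := by
        intro A
        by_contra hne
        obtain ⟨h1, h2, h3⟩ := hμ A hne
        have h4 := hG a (Finset.mem_insert_self _ _) hau h3
        have h5 := Finset.card_le_card h1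
        omega
      have hc' : c - koszulBoundary K n b ∈
          koszulChains (Ideal.span (sqfMonomial K '' (G : Set (Finset (Fin n))))) i j := by
        refine ⟨fun A => ?_, ?_⟩
        · have := hred A
          rw [hμ0] at this
          simpa using this
        · exact (Submodule.sub_mem _ hc (koszulBoundary_mem_koszulChains hb)).2
      obtain ⟨ν, b', hb', hbb'⟩ := hgen _ hc'
        (by rw [map_sub, hbd, koszulBoundary_koszulBoundary, sub_zero])
      refine ⟨ν, b + b',
        Submodule.add_mem _ hb (koszulChains_mono (span_mono_insert a) _ _ hb'), ?_⟩
      rw [map_add, ← hbb']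
      abel

theorem exists_of_gradedBetti_ne_zero (h : HasLinearQuotients G key V) {i j : ℕ}
    (hne : gradedBetti (Ideal.span (sqfMonomial K '' (G : Set (Finset (Fin n))))) i (i + j) ≠ 0) :
    ∃ u ∈ G, u.card = j ∧ i ≤ (V u).card := by
  by_contra! hcon
  apply hne
  rw [gradedBetti]
  have : ∀ c ∈ (koszulChains (Ideal.span (sqfMonomial K '' (G : Set (Finset (Fin n))))) i (i + j) ⊓
      LinearMap.ker (koszulBoundary K n)), c ∈ (koszulChains (Ideal.span (sqfMonomial K ''
        (G : Set (Finset (Fin n))))) (i + 1) (i + j)).map (koszulBoundary K n) := by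
    rintro c ⟨hc, hbd⟩
    exact h.exists_boundary_eq (fun u hu huj => hcon u hu (by omega)) hc hbd
  have hsub : Subsingleton ((koszulChains (Ideal.span (sqfMonomial K '' (G : Set (Finset (Fin n)))))
      i (i + j) ⊓ LinearMap.ker (koszulBoundary K n) : Submodule K _) ⧸
      ((koszulChains (Ideal.span (sqfMonomial K '' (G : Set (Finset (Fin n))))) (i + 1)
        (i + j)).map (koszulBoundary K n)).submoduleOf _) := by
    rw [Submodule.Quotient.subsingleton_iff, eq_top_iff]
    rintro ⟨c, hc⟩ -
    exact this c hc
  exact Module.finrank_zero_of_subsingleton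

theorem gradedBetti_eq_one (h : HasLinearQuotients G key V) {i j : ℕ}
    {u : Finset (Fin n)} (hu : u ∈ G) (hj : u.card = j) (hV : (V u).card = i)
    (hG : ∀ w ∈ G, w ≠ u → w.card = j → (V w).card < i) :
    gradedBetti (Ideal.span (sqfMonomial K '' (G : Set (Finset (Fin n))))) i (i + j) = 1 := by
  classical
  obtain ⟨z, hz, hzb, hz1, hgen⟩ := h.exists_generating_cycle (K := K) (i := i) (j := i + j) hu
    (by omega) hV (fun w hw hwu hwj => hG w hw hwu (by omega))
  rw [gradedBetti]
  refine finrank_eq_one (Submodule.Quotient.mk ⟨z, hz, hzb⟩) ?_ ?_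
  · rw [Ne, Submodule.Quotient.mk_eq_zero]
    rintro ⟨b, hb, hbz⟩
    -- A boundary has no such term: it would come from an element of the ideal with a term `u / x`,
    -- so some generator would properly divide `u`.
    have hcoef : (koszulBoundary K n b (V u)).coeff (Finsupp.indicator u fun _ _ => 1) = 1 := by
      rw [hbz]; exact hz1
    rw [koszulBoundary_apply, coeff_sum] at hcoef
    refine one_ne_zero (α := K) (hcoef.symm.trans (Finset.sum_eq_zero fun x hx => ?_))
    by_contra hne
    have h1 := coeff_koszulSign_mul_ne_zero hne
    rw [coeff_X_mul'] at h1
    split_ifs at h1 with h2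
    · obtain ⟨B, hB, hBm⟩ := mem_span_sqfMonomial_iff.1 (hb.1 _) _ h1
      have hBu : B ⊆ u.erase x := by
        intro y hy
        have h3 := hBm y hy
        rw [Finsupp.coe_tsub, Pi.sub_apply, Finsupp.indicator_apply, Finsupp.single_apply] at h3
        rw [Finset.mem_erase]
        constructor
        · rintro rfl
          apply h3
          split_ifs <;> simp_all
        · by_contra hyu
          simp [hyu] at h3
      have hxu : x ∈ u := by
        by_contra hxu
        simp [Finsupp.indicator_apply, hxu] at h2
      refine h.not_subset hu hB ?_ (hBu.trans (Finset.erase_subset _ _))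
      rintro rfl
      exact Finset.notMem_erase x B (hBu hxu)
    · exact h1 rfl
  · intro w
    obtain ⟨⟨c, hc, hbd⟩, rfl⟩ := Submodule.Quotient.mk_surjective _ w
    obtain ⟨μ, b, hb, heq⟩ := hgen c hc hbd
    refine ⟨μ, ?_⟩
    rw [← Submodule.Quotient.mk_smul, eq_comm, Submodule.Quotient.eq]
    exact ⟨b, hb, heq.symm⟩

end HasLinearQuotients

end LinearQuotients

/-! ### The componentwise order on spread monomials -/

section Spread

variable {n t : ℕ}

/-- The number of elements of `A` which are at most `x`. -/
def countLE (A : Finset (Fin n)) (x : Fin n) : ℕ := (A.filter (· ≤ x)).card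

/-- If `u₁ < u₂ < ⋯` and `v₁ < v₂ < ⋯ < v_e` are the elements of `u` and `v`, then `u` has at least
`e` elements and `u_p ≤ v_p` for all `p ≤ e`. -/
def Dominates (u v : Finset (Fin n)) : Prop := ∀ x, countLE v x ≤ countLE u x

theorem Dominates.of_subset {u v : Finset (Fin n)} (h : v ⊆ u) : Dominates u v :=
  fun _ => Finset.card_le_card (Finset.filter_subset_filter _ h)

theorem Dominates.trans {u v w : Finset (Fin n)} (h : Dominates u v) (h' : Dominates v w) :
    Dominates u w := fun x => (h' x).trans (h x)

theorem countLE_le_card (A : Finset (Fin n)) (x : Fin n) : countLE A x ≤ A.card :=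
  Finset.card_filter_le _ _

theorem countLE_eq_card {A : Finset (Fin n)} {x : Fin n} (h : ∀ y ∈ A, y ≤ x) :
    countLE A x = A.card := by
  rw [countLE, Finset.filter_true_of_mem h]

theorem countLE_mono (A : Finset (Fin n)) {x y : Fin n} (h : x ≤ y) : countLE A x ≤ countLE A y :=
  Finset.card_le_card (Finset.monotone_filter_right _ fun _ _ ha => ha.trans h)

theorem Dominates.card_le {u v : Finset (Fin n)} (h : Dominates u v) : v.card ≤ u.card := by
  rcases v.eq_empty_or_nonempty with rfl | hv
  · simp
  · rw [← countLE_eq_card (x := v.max' hv) (fun y hy => Finset.le_max' v y hy)]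
    exact (h _).trans (countLE_le_card _ _)

theorem countLE_eq (A : Finset (Fin n)) (x : Fin n) :
    countLE A x = (A.filter (· < x)).card + if x ∈ A then 1 else 0 := by
  have : A.filter (· ≤ x) = A.filter (· < x) ∪ A.filter (· = x) := by
    ext y
    simp only [Finset.mem_filter, Finset.mem_union, le_iff_lt_or_eq, and_or_left]
  rw [countLE, this, Finset.card_union_of_disjoint, Finset.filter_eq']
  · split_ifs <;> simp
  · rw [Finset.disjoint_left]
    intro y hy hy'
    exact (ne_of_lt (Finset.mem_filter.1 hy).2) (Finset.mem_filter.1 hy').2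

theorem countLE_insert {A : Finset (Fin n)} {i : Fin n} (hi : i ∉ A) (x : Fin n) :
    countLE (insert i A) x = countLE A x + if i ≤ x then 1 else 0 := by
  rw [countLE, Finset.filter_insert]
  split_ifs
  · rw [Finset.card_insert_of_notMem (by simp [hi])]; rfl
  · rfl

theorem countLE_move {A : Finset (Fin n)} {i j : Fin n} (hi : i ∉ A) (hj : j ∈ A) (x : Fin n) :
    countLE (insert i (A.erase j)) x + (if j ≤ x then 1 else 0)
      = countLE A x + if i ≤ x then 1 else 0 := by
  rw [countLE_insert (fun h => hi (Finset.mem_of_mem_erase h))]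
  have := countLE_insert (Finset.notMem_erase j A) x
  rw [Finset.insert_erase hj] at this
  omega

theorem card_move {A : Finset (Fin n)} {i j : Fin n} (hi : i ∉ A) (hj : j ∈ A) :
    (insert i (A.erase j)).card = A.card := by
  rw [Finset.card_insert_of_notMem (fun h => hi (Finset.mem_of_mem_erase h)),
    Finset.card_erase_add_one hj]

theorem exists_first_difference {u v : Finset (Fin n)} (h : u ≠ v) :
    ∃ x, ¬ (x ∈ u ↔ x ∈ v) ∧ ∀ y < x, (y ∈ u ↔ y ∈ v) := by
  have hne : (Finset.univ.filter fun x => ¬ (x ∈ u ↔ x ∈ v)).Nonempty := by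
    by_contra hcon
    apply h
    ext x
    by_contra hx
    exact hcon ⟨x, by simpa using hx⟩
  refine ⟨_, (Finset.mem_filter.1 (Finset.min'_mem _ hne)).2, fun y hy => ?_⟩
  by_contra hcon
  exact absurd (Finset.min'_le _ y (by simpa using hcon)) (not_le.2 hy)

/-- Below the first difference the counts agree, so the extra element there must belong to `u`. -/
theorem Dominates.slexGT {u v : Finset (Fin n)} (h : Dominates u v) (hne : u ≠ v) : SlexGT u v := by
  obtain ⟨x, hx, hlt⟩ := exists_first_difference hne
  have h1 := h x
  have h2 : u.filter (· < x) = v.filter (· < x) := by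
    ext y
    simp only [Finset.mem_filter]
    exact ⟨fun hy => ⟨(hlt y hy.2).1 hy.1, hy.2⟩, fun hy => ⟨(hlt y hy.2).2 hy.1, hy.2⟩⟩
  rw [countLE_eq, countLE_eq, h2] at h1
  by_cases hu : x ∈ u
  · exact ⟨x, hu, fun hv => hx ⟨fun _ => hv, fun _ => hu⟩, hlt⟩
  · by_cases hv : x ∈ v
    · simp [hu, hv] at h1
    · exact absurd ⟨fun h => absurd h hu, fun h => absurd h hv⟩ hx

theorem SlexGT.asymm {u v : Finset (Fin n)} (h : SlexGT u v) : ¬ SlexGT v u := by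
  rintro ⟨y, hyv, hyu, hy⟩
  obtain ⟨x, hxu, hxv, hx⟩ := h
  rcases lt_trichotomy x y with hxy | rfl | hxy
  · exact hxv ((hy x hxy).2 hxu)
  · exact hyu hxu
  · exact hyu ((hx y hxy).2 hyv)

theorem IsSpread.subset {u v : Finset (Fin n)} (hu : IsSpread t u) (h : v ⊆ u) : IsSpread t v :=
  fun i hi j hj hij => hu i (h hi) j (h hj) hij

/-- Replacing the element of `v` which follows `x ∉ v` by `x` keeps `v` spread, provided the
preceding elements are at distance at least `t`. -/
theorem IsSpread.move {v : Finset (Fin n)} (hv : IsSpread t v) {x l : Fin n} (hl : l ∈ v)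
    (hxl : x < l) (hlow : ∀ y ∈ v, y < x → y.val + t ≤ x.val)
    (hnext : ∀ y ∈ v, x ≤ y → l ≤ y) : IsSpread t (insert x (v.erase l)) := by
  intro a ha b hb hab
  rcases Finset.mem_insert.1 ha with rfl | ha
  · rcases Finset.mem_insert.1 hb with rfl | hb
    · exact absurd hab (lt_irrefl _)
    · obtain ⟨hbl, hb⟩ := Finset.mem_erase.1 hb
      have h1 := lt_of_le_of_ne (hnext b hb hab.le) (Ne.symm hbl)
      have h2 := hv l hl b hb h1
      have h3 : a.val < l.val := hxl
      omega
  · have hav := Finset.mem_of_mem_erase ha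
    rcases Finset.mem_insert.1 hb with rfl | hb
    · exact hlow a hav hab
    · exact hv a hav b (Finset.mem_of_mem_erase hb) hab

theorem SpreadBorel.exists_dominates {U : Set (Finset (Fin n))} {A : Finset (Fin n)}
    (h : SpreadBorel t U A) : ∃ u ∈ U, A.card = u.card ∧ Dominates A u := by
  induction h with
  | base A hA => exact ⟨A, hA, rfl, fun _ => le_rfl⟩
  | move A i j hA hj hij hi hs ih =>
    obtain ⟨u, hu, hcard, hdom⟩ := ih
    refine ⟨u, hu, by rw [card_move hi hj, hcard], fun x => (hdom x).trans ?_⟩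
    have := countLE_move hi hj x
    split_ifs at this with h1 h2
    · omega
    · exact absurd (hij.le.trans h1) h2
    · omega
    · omega

theorem SpreadBorel.isSpread {U : Set (Finset (Fin n))} (hU : ∀ A ∈ U, IsSpread t A)
    {A : Finset (Fin n)} (h : SpreadBorel t U A) : IsSpread t A := by
  cases h with
  | base _ h => exact hU _ h
  | move _ _ _ _ _ _ _ hs => exact hs

/-- In equal degree the componentwise order is exactly what Borel moves reach. At the first
difference `x ∈ u`, the next element of `v` is moved down to `x`; the result is still spread and
still dominated by `u`, and its sum of indices is smaller. -/
theorem SpreadBorel.of_dominates {U : Set (Finset (Fin n))} {u v : Finset (Fin n)}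
    (hv : SpreadBorel t U v) (hvs : IsSpread t v) (hus : IsSpread t u) (hcard : u.card = v.card)
    (hdom : Dominates u v) : SpreadBorel t U u := by
  induction hN : ∑ a ∈ v, a.val using Nat.strong_induction_on generalizing v with
  | _ N ih =>
  rcases eq_or_ne u v with rfl | hne
  · exact hv
  obtain ⟨x, hxu, hxv, hx⟩ := hdom.slexGT hne
  have hfilter : u.filter (· < x) = v.filter (· < x) := by
    ext y
    simp only [Finset.mem_filter]
    exact ⟨fun hy => ⟨(hx y hy.2).1 hy.1, hy.2⟩, fun hy => ⟨(hx y hy.2).2 hy.1, hy.2⟩⟩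
  have hcount : countLE u x = countLE v x + 1 := by
    rw [countLE_eq, countLE_eq, hfilter, if_pos hxu, if_neg hxv, add_zero]
  have hne' : (v.filter (x < ·)).Nonempty := by
    by_contra hcon
    have : countLE v x = v.card := countLE_eq_card fun y hy => by
      by_contra hxy
      exact hcon ⟨y, Finset.mem_filter.2 ⟨hy, not_le.1 hxy⟩⟩
    have := countLE_le_card u x
    omega
  obtain ⟨l, hl⟩ : ∃ l, l = (v.filter (x < ·)).min' hne' := ⟨_, rfl⟩
  obtain ⟨hlv, hxl⟩ : l ∈ v ∧ x < l := Finset.mem_filter.1 (hl ▸ Finset.min'_mem _ hne')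
  have hnext : ∀ y ∈ v, x ≤ y → l ≤ y := fun y hy hxy => by
    rw [hl]
    refine Finset.min'_le _ _ (Finset.mem_filter.2 ⟨hy, lt_of_le_of_ne hxy ?_⟩)
    rintro rfl
    exact hxv hy
  have hs := hvs.move hlv hxl (fun y hy hyx => hus y ((hx y hyx).2 hy) x hxu hyx) hnext
  refine ih _ ?_ (SpreadBorel.move v x l hv hlv hxl hxv hs) hs (by rw [hcard, card_move hxv hlv])
    (fun y => ?_) rfl
  · rw [Finset.sum_insert (fun h => hxv (Finset.mem_of_mem_erase h)), ← hN,
      ← Finset.add_sum_erase _ _ hlv]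
    exact Nat.add_lt_add_right hxl _
  · have h1 := countLE_move hxv hlv y
    have h2 := hdom y
    split_ifs at h1 with h3 h4 h4
    · omega
    · omega
    · have h5 : countLE v y ≤ countLE v x := by
        refine Finset.card_le_card fun z hz => ?_
        obtain ⟨hzv, hzy⟩ := Finset.mem_filter.1 hz
        refine Finset.mem_filter.2 ⟨hzv, ?_⟩
        by_contra hzx
        exact h3 ((hnext z hzv (not_le.1 hzx).le).trans hzy)
      have := countLE_mono u h4
      omega
    · omega

/-- Discarding the largest elements of `u` preserves domination as long as `u` has more elements
than `v`. -/
theorem Dominates.exists_subset {u v : Finset (Fin n)} (h : Dominates u v) :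
    ∃ w ⊆ u, w.card = v.card ∧ Dominates w v := by
  induction hN : u.card using Nat.strong_induction_on generalizing u with
  | _ N ih =>
  rcases eq_or_lt_of_le h.card_le with heq | hlt
  · exact ⟨u, subset_rfl, heq.symm, h⟩
  have hu : u.Nonempty := Finset.card_pos.1 (by omega)
  have hm := Finset.max'_mem u hu
  have hdom : Dominates (u.erase (u.max' hu)) v := by
    intro x
    have h1 := countLE_insert (Finset.notMem_erase (u.max' hu) u) x
    rw [Finset.insert_erase hm] at h1
    have h2 := h x
    split_ifs at h1 with h3
    · have h4 := countLE_eq_card (A := u) (x := x) fun y hy => (Finset.le_max' u y hy).trans h3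
      have h5 := countLE_le_card v x
      omega
    · omega
  obtain ⟨w, hw, hcard, hwdom⟩ := ih _ (by rw [← hN]; exact Finset.card_erase_lt_of_mem hm) hdom rfl
  exact ⟨w, hw.trans (Finset.erase_subset _ _), hcard, hwdom⟩

/-! ### Iterated shadows in terms of domination -/

theorem mem_iterate_spreadShadow {T : Set (Finset (Fin n))} {m : ℕ} {u : Finset (Fin n)}
    (hu : IsSpread t u) :
    u ∈ (spreadShadow t)^[m] T ↔ ∃ w ∈ T, w ⊆ u ∧ u.card = w.card + m := by
  induction m generalizing u with
  | zero =>
    constructor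
    · exact fun h => ⟨u, h, subset_rfl, rfl⟩
    · rintro ⟨w, hw, hsub, hcard⟩
      rwa [← Finset.eq_of_subset_of_card_le hsub hcard.le]
  | succ m ih =>
    rw [Function.iterate_succ_apply']
    constructor
    · rintro ⟨_, w, hw, i, hi, rfl⟩
      obtain ⟨w', hw', hsub, hcard⟩ := (ih (hu.subset (Finset.subset_insert _ _))).1 hw
      exact ⟨w', hw', hsub.trans (Finset.subset_insert _ _),
        by rw [Finset.card_insert_of_notMem hi]; omega⟩
    · rintro ⟨w, hw, hsub, hcard⟩
      obtain ⟨i, hiu, hiw⟩ := Finset.exists_mem_notMem_of_card_lt_card (s := w) (t := u) (by omega)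
      refine ⟨hu, u.erase i, (ih (hu.subset (Finset.erase_subset _ _))).2 ⟨w, hw, ?_, ?_⟩, i,
        Finset.notMem_erase _ _, (Finset.insert_erase hiu).symm⟩
      · exact fun y hy => Finset.mem_erase.2 ⟨fun h => hiw (h ▸ hy), hsub hy⟩
      · rw [Finset.card_erase_of_mem hiu]; omega

theorem mem_iterate_spreadShadow_spreadBorel {m : ℕ} {u ω : Finset (Fin n)}
    (hu : IsSpread t u) (hω : IsSpread t ω) (hcard : u.card = ω.card + m) :
    u ∈ (spreadShadow t)^[m] {A | SpreadBorel t {ω} A} ↔ Dominates u ω := by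
  rw [mem_iterate_spreadShadow hu]
  constructor
  · rintro ⟨w, hw, hsub, -⟩
    obtain ⟨_, rfl, -, hdom⟩ := SpreadBorel.exists_dominates hw
    exact (Dominates.of_subset hsub).trans hdom
  · intro h
    obtain ⟨w, hsub, hwcard, hdom⟩ := h.exists_subset
    exact ⟨w, (SpreadBorel.base ω (Set.mem_singleton ω)).of_dominates hω (hu.subset hsub) hwcard hdom, hsub,
      by omega⟩

theorem exists_maxIndex_eq {u : Finset (Fin n)} (hu : u.Nonempty) :
    ∃ m ∈ u, maxIndex u = m.val + 1 ∧ ∀ y ∈ u, y ≤ m := by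
  refine ⟨u.max' hu, Finset.max'_mem u hu, le_antisymm ?_ ?_, fun y hy => Finset.le_max' u y hy⟩
  · exact Finset.sup_le fun y hy => Nat.succ_le_succ (Finset.le_max' u y hy)
  · exact Finset.le_sup (f := fun i : Fin n => i.val + 1) (Finset.max'_mem u hu)

theorem maxIndex_le (u : Finset (Fin n)) : maxIndex u ≤ n :=
  Finset.sup_le fun i _ => i.isLt

end Spread

/-! ### Spread strongly stable ideals have linear quotients -/

section StronglyStable

variable {K : Type*} [Field K] {n t : ℕ}

/-- A subset of `u` of the degree of `v` is reached from `v` by Borel moves, and `B_t(v) ≤ I` by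
minimality. -/
theorem IsSpreadStronglyStable.mem_of_dominates {I : Ideal (MvPolynomial (Fin n) K)}
    (hI : IsSpreadStronglyStable t I) {u v : Finset (Fin n)} (hv : IsSpread t v)
    (hu : IsSpread t u) (hdom : Dominates u v) (hvI : sqfMonomial K v ∈ I) :
    sqfMonomial K u ∈ I := by
  obtain ⟨w, hsub, hcard, hw⟩ := hdom.exists_subset
  have h1 := (SpreadBorel.base (t := t) v (Set.mem_singleton v)).of_dominates hv (hu.subset hsub)
    hcard hw
  have h2 : spreadBorelIdeal K t {v} ≤ I :=
    (isLeast_spreadBorelIdeal K t {v} (by simpa using hv)).2 ⟨hI, by simpa using hvI⟩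
  exact Ideal.mem_of_dvd _ (Finset.prod_dvd_prod_of_subset _ _ _ hsub)
    (h2 (Ideal.subset_span ⟨w, h1, rfl⟩))

open scoped Classical in
/-- The supports of the minimal squarefree monomials in `I`. -/
noncomputable def minimalSupports (I : Ideal (MvPolynomial (Fin n) K)) : Finset (Finset (Fin n)) :=
  Finset.univ.filter fun A => sqfMonomial K A ∈ I ∧ ∀ B, B ⊂ A → sqfMonomial K B ∉ I

theorem mem_minimalSupports {I : Ideal (MvPolynomial (Fin n) K)} {A : Finset (Fin n)} :
    A ∈ minimalSupports I ↔ sqfMonomial K A ∈ I ∧ ∀ B, B ⊂ A → sqfMonomial K B ∉ I := by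
  simp [minimalSupports]

theorem exists_minimalSupports_subset {I : Ideal (MvPolynomial (Fin n) K)} {A : Finset (Fin n)}
    (hA : sqfMonomial K A ∈ I) : ∃ B ∈ minimalSupports I, B ⊆ A := by
  induction A using Finset.strongInduction with
  | H A ih =>
  by_cases h : ∀ B, B ⊂ A → sqfMonomial K B ∉ I
  · exact ⟨A, mem_minimalSupports.2 ⟨hA, h⟩, subset_rfl⟩
  · push Not at h
    obtain ⟨B, hBA, hB⟩ := h
    obtain ⟨B', hB', hsub⟩ := ih B hBA hB
    exact ⟨B', hB', hsub.trans hBA.subset⟩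

theorem IsSpreadIdeal.isSpread_of_mem_minimalSupports {I : Ideal (MvPolynomial (Fin n) K)}
    (hI : IsSpreadIdeal t I) {A : Finset (Fin n)} (hA : A ∈ minimalSupports I) : IsSpread t A := by
  obtain ⟨G, hG, rfl⟩ := hI
  obtain ⟨h1, h2⟩ := mem_minimalSupports.1 hA
  obtain ⟨B, hB, hBA⟩ := (sqfMonomial_mem_span K G A).1 h1
  exact (Finset.eq_of_subset_of_card_le hBA (not_lt.1 fun hlt => h2 B
    (Finset.ssubset_iff_subset_ne.2 ⟨hBA, fun h => by simp [h] at hlt⟩)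
    (Ideal.subset_span ⟨B, hB, rfl⟩))) ▸ hG B hB

theorem IsSpreadIdeal.eq_span_minimalSupports {I : Ideal (MvPolynomial (Fin n) K)}
    (hI : IsSpreadIdeal t I) :
    I = Ideal.span (sqfMonomial K '' (minimalSupports I : Set (Finset (Fin n)))) := by
  refine le_antisymm ?_ (Ideal.span_le.2 ?_)
  · obtain ⟨G, hG, hIG⟩ := hI
    conv_lhs => rw [hIG]
    refine Ideal.span_le.2 ?_
    rintro _ ⟨A, hA, rfl⟩
    have hAI : sqfMonomial K A ∈ I := hIG ▸ Ideal.subset_span ⟨A, hA, rfl⟩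
    obtain ⟨B, hB, hBA⟩ := exists_minimalSupports_subset hAI
    exact (sqfMonomial_mem_span K _ A).2 ⟨B, hB, hBA⟩
  · rintro _ ⟨A, hA, rfl⟩
    exact (mem_minimalSupports.1 hA).1

/-- The variables generating the colon ideal at `u`. -/
def colonVariables (t : ℕ) (u : Finset (Fin n)) : Finset (Fin n) :=
  Finset.univ.filter fun x => x.val + 1 < maxIndex u ∧ ∀ l ∈ u, l ≤ x → l.val + t ≤ x.val

theorem mem_colonVariables {u : Finset (Fin n)} {x : Fin n} :
    x ∈ colonVariables t u ↔ x.val + 1 < maxIndex u ∧ ∀ l ∈ u, l ≤ x → l.val + t ≤ x.val := by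
  simp [colonVariables]

/-- The positions below `max(u)` split into the colon variables and the disjoint windows `[l, l +
t)` for the elements `l` of `u` other than the largest. -/
theorem card_colonVariables {u : Finset (Fin n)} (hu : IsSpread t u)
    (hne : u.Nonempty) : (colonVariables t u).card + t * (u.card - 1) + 1 = maxIndex u := by
  obtain ⟨m, hm, hmax, hle⟩ := exists_maxIndex_eq hne
  have hdec : Finset.range m.val = (colonVariables t u).image Fin.val ∪
      (u.erase m).biUnion fun l => Finset.Ico l.val (l.val + t) := by
    ext y
    simp only [Finset.mem_range, Finset.mem_union, Finset.mem_image, Finset.mem_biUnion,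
      Finset.mem_Ico, mem_colonVariables, Finset.mem_erase, hmax]
    constructor
    · intro hy
      by_cases h : ∃ l ∈ u, l.val ≤ y ∧ y < l.val + t
      · obtain ⟨l, hl, h1, h2⟩ := h
        refine Or.inr ⟨l, ⟨?_, hl⟩, h1, h2⟩
        rintro rfl
        omega
      · push Not at h
        exact Or.inl ⟨⟨y, hy.trans m.isLt⟩, ⟨by simpa using hy, fun l hl hly => h l hl hly⟩, rfl⟩
    · rintro (⟨x, ⟨h1, -⟩, rfl⟩ | ⟨l, ⟨hlm, hl⟩, h1, h2⟩)
      · omega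
      · have := hu l hl m hm (lt_of_le_of_ne (hle l hl) hlm)
        omega
  have hdisj : Disjoint ((colonVariables t u).image Fin.val)
      ((u.erase m).biUnion fun l => Finset.Ico l.val (l.val + t)) := by
    rw [Finset.disjoint_left]
    intro y hy hy'
    obtain ⟨x, hx, rfl⟩ := Finset.mem_image.1 hy
    obtain ⟨l, hl, hlx⟩ := Finset.mem_biUnion.1 hy'
    rw [Finset.mem_Ico] at hlx
    have := (mem_colonVariables.1 hx).2 l (Finset.mem_of_mem_erase hl) hlx.1
    omega
  have hcard := congrArg Finset.card hdec
  rw [Finset.card_range, Finset.card_union_of_disjoint hdisj,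
    Finset.card_image_of_injective _ Fin.val_injective, Finset.card_biUnion] at hcard
  · simp only [Nat.card_Ico, Nat.add_sub_cancel_left, Finset.sum_const, smul_eq_mul,
      Finset.card_erase_of_mem hm] at hcard
    rw [hmax, hcard, mul_comm t]
  · intro a ha b hb hab
    rw [Function.onFun, Finset.disjoint_left]
    intro y hy hy'
    rw [Finset.mem_Ico] at hy hy'
    rcases lt_or_gt_of_ne hab with h | h
    · have := hu a (Finset.mem_of_mem_erase ha) b (Finset.mem_of_mem_erase hb) h
      omega
    · have := hu b (Finset.mem_of_mem_erase hb) a (Finset.mem_of_mem_erase ha) h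
      omega

/-- The order by degree, and by decreasing squarefree lexicographic order in each degree. -/
def degreeSlexKey (u : Finset (Fin n)) : ℕ ×ₗ Lex (Fin n → Bool) :=
  toLex (u.card, toLex fun x => decide (x ∉ u))

theorem degreeSlexKey_lt_iff {u w : Finset (Fin n)} :
    degreeSlexKey w < degreeSlexKey u ↔ w.card < u.card ∨ w.card = u.card ∧ SlexGT w u := by
  rw [degreeSlexKey, degreeSlexKey, Prod.Lex.toLex_lt_toLex]
  refine or_congr Iff.rfl (and_congr Iff.rfl ?_)
  constructor
  · rintro ⟨x, hlt, hx⟩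
    have h1 : x ∈ w ∧ x ∉ u := by
      revert hx
      by_cases hw : x ∈ w <;> by_cases hu : x ∈ u <;> simp [hw, hu]
    refine ⟨x, h1.1, h1.2, fun y hy => ?_⟩
    have := hlt y hy
    simpa using this
  · rintro ⟨x, hw, hu, hx⟩
    exact ⟨x, fun y hy => by simp [hx y hy], by simp [hw, hu]⟩

theorem degreeSlexKey_injective : Function.Injective (degreeSlexKey (n := n)) := by
  intro u w h
  by_contra hne
  obtain ⟨x, hx, -⟩ := exists_first_difference hne
  have h1 := congrFun (congrArg (fun p => ofLex (ofLex p).2) h) x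
  simp only [degreeSlexKey, ofLex_toLex, decide_eq_decide] at h1
  exact hx (not_iff_not.1 h1)

theorem card_le_of_degreeSlexKey_le {u w : Finset (Fin n)}
    (h : degreeSlexKey w ≤ degreeSlexKey u) : w.card ≤ u.card := by
  rcases h.eq_or_lt with h | h
  · rw [degreeSlexKey_injective h]
  · rcases degreeSlexKey_lt_iff.1 h with h | h
    · exact h.le
    · exact h.1.le

/-- If an earlier generator `w` avoided the colon variables of `u`, then `u` would dominate `w`,
contradicting minimality of `u` or the order. Conversely a colon variable `x` may replace the next
element of `u`, giving an element of the ideal that divides `x u`. -/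
theorem IsSpreadStronglyStable.hasLinearQuotients (ht : 1 ≤ t)
    {I : Ideal (MvPolynomial (Fin n) K)} (hI : IsSpreadStronglyStable t I) :
    HasLinearQuotients (minimalSupports I) degreeSlexKey (colonVariables t) where
  disj u _ := by
    rw [Finset.disjoint_left]
    intro x hx hxu
    have := (mem_colonVariables.1 hx).2 x hxu le_rfl
    omega
  meets u hu w hw hne hle := by
    by_contra hcon
    push Not at hcon
    have hus := hI.1.isSpread_of_mem_minimalSupports hu
    have hws := hI.1.isSpread_of_mem_minimalSupports hw
    have hcard := card_le_of_degreeSlexKey_le hle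
    have hdom : Dominates u w := by
      intro x
      by_cases hx : ∀ y ∈ u, y ≤ x
      · rw [countLE_eq_card hx]
        exact (countLE_le_card _ _).trans hcard
      · push Not at hx
        obtain ⟨m, hm, hxm⟩ := hx
        -- Each element of `w` up to `x` falls in a window `[l, l + t)` with `l ∈ u`. Elements of
        -- `w` are `t` apart, so distinct ones use distinct windows.
        have hex : ∀ y ∈ w, y ≤ x → ∃ l ∈ u, l ≤ y ∧ y.val < l.val + t := by
          intro y hy hyx
          by_contra hcon'
          push Not at hcon'
          refine hcon y (mem_colonVariables.2 ⟨?_, hcon'⟩) hy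
          refine lt_of_lt_of_le ?_ (Finset.le_sup (f := fun i : Fin n => i.val + 1) hm)
          exact Nat.succ_lt_succ (lt_of_le_of_lt hyx hxm)
        choose! f hfu hfle hflt using hex
        refine Finset.card_le_card_of_injOn f (fun y hy => ?_) (fun y hy z hz hyz => ?_)
        · obtain ⟨hyw, hyx⟩ := Finset.mem_filter.1 hy
          exact Finset.mem_filter.2 ⟨hfu y hyw hyx, (hfle y hyw hyx).trans hyx⟩
        · obtain ⟨hyw, hyx⟩ := Finset.mem_filter.1 hy
          obtain ⟨hzw, hzx⟩ := Finset.mem_filter.1 hz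
          have h1 : (f y).val ≤ y.val := hfle y hyw hyx
          have h2 : (f z).val ≤ z.val := hfle z hzw hzx
          have h3 := hflt y hyw hyx
          have h4 := hflt z hzw hzx
          rw [hyz] at h1 h3
          rcases lt_trichotomy y z with h | h | h
          · have := hws y hyw z hzw h
            omega
          · exact h
          · have := hws z hzw y hyw h
            omega
    rcases degreeSlexKey_lt_iff.1 (lt_of_le_of_ne hle (degreeSlexKey_injective.ne hne))
      with h | ⟨-, h⟩
    · obtain ⟨u', hsub, hcard', hdom'⟩ := hdom.exists_subset
      refine (mem_minimalSupports.1 hu).2 u' (Finset.ssubset_iff_subset_ne.2 ⟨hsub, ?_⟩)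
        (hI.mem_of_dominates hws (hus.subset hsub) hdom' (mem_minimalSupports.1 hw).1)
      rintro rfl
      omega
    · exact h.asymm (hdom.slexGT (Ne.symm hne))
  covers u hu x hx := by
    obtain ⟨hxmax, hxlow⟩ := mem_colonVariables.1 hx
    have hus := hI.1.isSpread_of_mem_minimalSupports hu
    have hune : u.Nonempty := by
      by_contra hcon
      rw [Finset.not_nonempty_iff_eq_empty] at hcon
      simp [hcon, maxIndex] at hxmax
    obtain ⟨m, hm, hmax, -⟩ := exists_maxIndex_eq hune
    have hxu : x ∉ u := fun h => by
      have := hxlow x h le_rfl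
      omega
    have hne : (u.filter (x < ·)).Nonempty :=
      ⟨m, Finset.mem_filter.2 ⟨hm, Fin.lt_def.2 (by omega)⟩⟩
    obtain ⟨l, hl⟩ : ∃ l, l = (u.filter (x < ·)).min' hne := ⟨_, rfl⟩
    obtain ⟨hlu, hxl⟩ : l ∈ u ∧ x < l := Finset.mem_filter.1 (hl ▸ Finset.min'_mem _ hne)
    have hs : IsSpread t (insert x (u.erase l)) := by
      refine hus.move hlu hxl (fun y hy hyx => hxlow y hy hyx.le) fun y hy hxy => ?_
      rw [hl]
      refine Finset.min'_le _ _ (Finset.mem_filter.2 ⟨hy, lt_of_le_of_ne hxy ?_⟩)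
      rintro rfl
      exact hxu hy
    obtain ⟨w, hw, hsub⟩ := exists_minimalSupports_subset
      (hI.2 u hus (mem_minimalSupports.1 hu).1 l hlu x hxl hxu hs)
    refine ⟨w, hw, degreeSlexKey_lt_iff.2 ?_,
      hsub.trans (Finset.insert_subset_insert _ (Finset.erase_subset _ _))⟩
    have h1 := Finset.card_le_card hsub
    rw [card_move hxu hlu] at h1
    -- A generator of full degree equals the moved monomial, which contains `x` and agrees with `u`
    -- below it, hence is slex-larger than `u`.
    rcases h1.lt_or_eq with h | h
    · exact Or.inl h
    · refine Or.inr ⟨h, ?_⟩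
      rw [Finset.eq_of_subset_of_card_le hsub (by rw [card_move hxu hlu, h])]
      refine ⟨x, Finset.mem_insert_self _ _, hxu, fun y hy => ?_⟩
      rw [Finset.mem_insert, Finset.mem_erase]
      constructor
      · rintro (rfl | h)
        · exact absurd hy (lt_irrefl _)
        · exact h.2
      · exact fun h => Or.inr ⟨ne_of_lt (hy.trans hxl), h⟩
  card_le _ _ _ _ := card_le_of_degreeSlexKey_le

end StronglyStable

/-! ### Increasing enumerations of spread monomials -/

section Enumeration

variable {n t : ℕ}

/-- `f 0 < f 1 < ⋯ < f (e - 1)` are the elements of `A`. -/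
structure Enumerates (f : ℕ → ℕ) (e : ℕ) (A : Finset (Fin n)) : Prop where
  strict : ∀ p q, p < q → q < e → f p < f q
  mem_iff : ∀ x : Fin n, x ∈ A ↔ ∃ p < e, f p = x.val
  lt : ∀ p < e, f p < n

namespace Enumerates

variable {f g : ℕ → ℕ} {e e' : ℕ} {A B : Finset (Fin n)}

theorem le_iff (h : Enumerates f e A) {p q : ℕ} (hp : p < e) (hq : q < e) : f p ≤ f q ↔ p ≤ q := by
  constructor
  · intro hle
    by_contra hcon
    have := h.strict q p (not_le.1 hcon) hp
    omega
  · intro hle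
    rcases hle.eq_or_lt with rfl | hlt
    · exact le_rfl
    · exact (h.strict p q hlt hq).le

theorem countLE_eq (h : Enumerates f e A) (x : Fin n) :
    countLE A x = ((Finset.range e).filter fun p => f p ≤ x.val).card := by
  symm
  refine Finset.card_bij (fun p hp => ⟨f p, h.lt p (by simp at hp; exact hp.1)⟩) ?_ ?_ ?_
  · intro p hp
    rw [Finset.mem_filter, Finset.mem_range] at hp
    exact Finset.mem_filter.2 ⟨(h.mem_iff _).2 ⟨p, hp.1, rfl⟩, hp.2⟩
  · intro p hp q hq hpq
    rw [Finset.mem_filter, Finset.mem_range] at hp hq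
    rw [Fin.mk.injEq] at hpq
    exact le_antisymm ((h.le_iff hp.1 hq.1).1 hpq.le) ((h.le_iff hq.1 hp.1).1 hpq.ge)
  · intro y hy
    obtain ⟨hyA, hyx⟩ := Finset.mem_filter.1 hy
    obtain ⟨p, hp, hpy⟩ := (h.mem_iff y).1 hyA
    exact ⟨p, Finset.mem_filter.2 ⟨Finset.mem_range.2 hp, by rw [hpy]; exact hyx⟩, Fin.ext hpy⟩

theorem card_eq (h : Enumerates f e A) : A.card = e := by
  symm
  rw [← Finset.card_range e]
  refine Finset.card_bij (fun p hp => ⟨f p, h.lt p (Finset.mem_range.1 hp)⟩) ?_ ?_ ?_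
  · exact fun p hp => (h.mem_iff _).2 ⟨p, Finset.mem_range.1 hp, rfl⟩
  · intro p hp q hq hpq
    rw [Finset.mem_range] at hp hq
    rw [Fin.mk.injEq] at hpq
    exact le_antisymm ((h.le_iff hp hq).1 hpq.le) ((h.le_iff hq hp).1 hpq.ge)
  · intro y hy
    obtain ⟨p, hp, hpy⟩ := (h.mem_iff y).1 hy
    exact ⟨p, Finset.mem_range.2 hp, Fin.ext hpy⟩

theorem dominates_iff (h : Enumerates f e A) (h' : Enumerates g e' B) :
    Dominates A B ↔ e' ≤ e ∧ ∀ p < e', f p ≤ g p := by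
  constructor
  · intro hdom
    have hle : e' ≤ e := by
      rw [← h.card_eq, ← h'.card_eq]
      exact hdom.card_le
    refine ⟨hle, fun p hp => ?_⟩
    by_contra hcon
    have h1 := hdom ⟨g p, h'.lt p hp⟩
    rw [h.countLE_eq, h'.countLE_eq] at h1
    have h2 : Finset.range (p + 1) ⊆ (Finset.range e').filter fun q => g q ≤ g p := by
      intro q hq
      rw [Finset.mem_range] at hq
      rw [Finset.mem_filter, Finset.mem_range]
      exact ⟨by omega, (h'.le_iff (by omega) hp).2 (by omega)⟩
    have h3 : ((Finset.range e).filter fun q => f q ≤ g p) ⊆ Finset.range p := by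
      intro q hq
      rw [Finset.mem_filter, Finset.mem_range] at hq
      rw [Finset.mem_range]
      by_contra hqp
      have := (h.le_iff (hp.trans_le hle) hq.1).2 (not_lt.1 hqp)
      omega
    have h4 := Finset.card_le_card h2
    have h5 := Finset.card_le_card h3
    rw [Finset.card_range] at h4 h5
    simp only at h1
    omega
  · rintro ⟨hle, hfg⟩ x
    rw [h.countLE_eq, h'.countLE_eq]
    refine Finset.card_le_card fun p hp => ?_
    rw [Finset.mem_filter, Finset.mem_range] at hp ⊢
    exact ⟨by omega, (hfg p hp.1).trans hp.2⟩

theorem maxIndex_eq (h : Enumerates f (e + 1) A) : maxIndex A = f e + 1 := by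
  refine le_antisymm (Finset.sup_le fun x hx => ?_) ?_
  · obtain ⟨p, hp, hpx⟩ := (h.mem_iff x).1 hx
    rw [← hpx]
    exact Nat.succ_le_succ ((h.le_iff hp (by omega)).2 (by omega))
  · exact Finset.le_sup (f := fun i : Fin n => i.val + 1)
      (b := ⟨f e, h.lt e (by omega)⟩) ((h.mem_iff _).2 ⟨e, by omega, rfl⟩)

theorem slexGT (h : Enumerates f e A) (h' : Enumerates g e B) {p : ℕ} (hp : p < e)
    (hlt : f p < g p) (heq : ∀ q < p, f q = g q) : SlexGT A B := by
  refine ⟨⟨f p, h.lt p hp⟩, (h.mem_iff _).2 ⟨p, hp, rfl⟩, fun hB => ?_, fun y hy => ?_⟩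
  · obtain ⟨q, hq, hqp⟩ := (h'.mem_iff _).1 hB
    simp only at hqp
    rcases lt_or_ge q p with hqp' | hqp'
    · have := h.strict q p hqp' hp
      rw [heq q hqp'] at this
      omega
    · have := (h'.le_iff hp hq).2 hqp'
      omega
  · have hy' : y.val < f p := hy
    rw [h.mem_iff, h'.mem_iff]
    constructor
    · rintro ⟨q, hq, hqy⟩
      refine ⟨q, hq, ?_⟩
      have : q < p := by
        by_contra hcon
        have := (h.le_iff hp hq).2 (not_lt.1 hcon)
        omega
      rw [← heq q this, hqy]
    · rintro ⟨q, hq, hqy⟩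
      refine ⟨q, hq, ?_⟩
      have : q < p := by
        by_contra hcon
        have := (h'.le_iff hp hq).2 (not_lt.1 hcon)
        omega
      rw [heq q this, hqy]

theorem eq_of_forall_eq (h : Enumerates f e A) (h' : Enumerates g e B)
    (heq : ∀ q < e, f q = g q) : A = B := by
  ext x
  rw [h.mem_iff, h'.mem_iff]
  exact exists_congr fun q => and_congr_right fun hq => by rw [heq q hq]

theorem isSpread {o : ℕ → ℕ} (h : Enumerates (fun p => p * t + o p) e A)
    (ho : ∀ p q, p ≤ q → q < e → o p ≤ o q) : IsSpread t A := by
  intro x hx y hy hxy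
  obtain ⟨p, hp, hpx⟩ := (h.mem_iff x).1 hx
  obtain ⟨q, hq, hqy⟩ := (h.mem_iff y).1 hy
  have hpq : p < q := by
    by_contra hcon
    have := (h.le_iff hq hp).2 (not_lt.1 hcon)
    have hxy' : x.val < y.val := hxy
    omega
  have h1 := ho p q hpq.le hq
  have h2 := Nat.mul_le_mul_right t (Nat.succ_le_of_lt hpq)
  rw [Nat.succ_mul] at h2
  omega

end Enumerates

/-- Subtracting `p * t` from the `p`-th index turns the spread condition into monotonicity, which
makes both domination and slex comparison statements about offsets. -/
theorem IsSpread.exists_enumerates {A : Finset (Fin n)} (hA : IsSpread t A) {e : ℕ}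
    (he : A.card = e) : ∃ o : ℕ → ℕ, (∀ p q, p ≤ q → q < e → o p ≤ o q) ∧
      Enumerates (fun p => p * t + o p) e A := by
  set f : ℕ → ℕ := fun p => if hp : p < e then (A.orderEmbOfFin he ⟨p, hp⟩).val else 0 with hf
  have hfp : ∀ p (hp : p < e), f p = (A.orderEmbOfFin he ⟨p, hp⟩).val := fun p hp => by
    rw [hf]; exact dif_pos hp
  have hstrict : ∀ p q, p < q → q < e → f p < f q := by
    intro p q hpq hq
    rw [hfp p (hpq.trans hq), hfp q hq]
    exact (A.orderEmbOfFin he).strictMono (Fin.mk_lt_mk.2 hpq)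
  have hstep : ∀ p, p + 1 < e → f p + t ≤ f (p + 1) := by
    intro p hp
    have h1 := hstrict p (p + 1) (by omega) hp
    rw [hfp p (by omega), hfp _ hp] at h1 ⊢
    exact hA _ (Finset.orderEmbOfFin_mem _ _ _) _ (Finset.orderEmbOfFin_mem _ _ _) h1
  have hlow : ∀ p < e, p * t ≤ f p := by
    intro p
    induction p with
    | zero => intro _; rw [Nat.zero_mul]; exact Nat.zero_le _
    | succ p ih =>
      intro hp
      have h1 := ih (by omega)
      have h2 := hstep p hp
      rw [Nat.succ_mul]
      omega
  have hoff : ∀ p < e, p * t + (f p - p * t) = f p := fun p hp => by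
    have := hlow p hp
    omega
  refine ⟨fun p => f p - p * t, fun p q hpq hq => ?_, ⟨fun p q hpq hq => ?_, fun x => ?_,
    fun p hp => ?_⟩⟩
  · induction q, hpq using Nat.le_induction with
    | base => exact le_rfl
    | succ q hpq ih =>
      refine (ih (by omega)).trans ?_
      have h1 := hlow q (by omega)
      have h2 := hstep q hq
      simp only [Nat.succ_mul]
      omega
  · simp only
    rw [hoff p (by omega), hoff q hq]
    exact hstrict p q hpq hq
  · have hrange : x ∈ A ↔ ∃ p : Fin e, A.orderEmbOfFin he p = x := by
      rw [← Finset.mem_coe, ← Finset.range_orderEmbOfFin A he, Set.mem_range]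
    rw [hrange]
    constructor
    · rintro ⟨⟨p, hp⟩, rfl⟩
      exact ⟨p, hp, by rw [hoff p hp, hfp p hp]⟩
    · rintro ⟨p, hp, hpx⟩
      rw [hoff p hp, hfp p hp] at hpx
      exact ⟨⟨p, hp⟩, Fin.ext hpx⟩
  · rw [hoff p hp, hfp p hp]
    exact Fin.isLt _

theorem enumerates_filter (ht : 1 ≤ t) {e : ℕ} {o : ℕ → ℕ}
    (ho : ∀ p q, p ≤ q → q < e → o p ≤ o q) (hlt : ∀ p < e, p * t + o p < n) :
    Enumerates (fun p => p * t + o p) e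
      (Finset.univ.filter fun x : Fin n => ∃ p < e, p * t + o p = x.val) where
  strict p q hpq hq := by
    have h1 := ho p q hpq.le hq
    have h2 := Nat.mul_le_mul_right t (Nat.succ_le_of_lt hpq)
    rw [Nat.succ_mul] at h2
    omega
  mem_iff x := by simp
  lt := hlt

end Enumeration

/-! ### The monomials attaining the bound -/

section ExtremalMonomials

/-- The differences between the indices of the monomial `ω_j` of degree `c + j + 3` and those of
`x_1 x_{1+t} x_{1+2t} ⋯`; here `M` is the difference for the last index. -/
def extremalOffset (c j M p : ℕ) : ℕ :=
  if j ≤ M then if p < c + j + 2 then min (p - c) j else M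
  else if p + 2 ≤ c + M then p - c else M

theorem extremalOffset_mono {c j M p q : ℕ} (hpq : p ≤ q) :
    extremalOffset c j M p ≤ extremalOffset c j M q := by
  unfold extremalOffset
  split_ifs <;> omega

theorem extremalOffset_last (c j M : ℕ) : extremalOffset c j M (c + j + 2) = M := by
  unfold extremalOffset
  split_ifs <;> omega

/-- Supplies a position witnessing that `ω_j` does not dominate `ω_i`. The gap `M + 2 ≤ M'` reflects
that each extra degree lowers the last offset by `t ≥ 2`. -/
theorem exists_extremalOffset_lt {c i j M M' : ℕ} (hM : 1 ≤ M) (hij : i < j) (hM' : M + 2 ≤ M') :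
    ∃ p < c + i + 3, extremalOffset c i M' p < extremalOffset c j M p := by
  by_cases h1 : j ≤ M
  · refine ⟨c + i + 1, by omega, ?_⟩
    unfold extremalOffset
    split_ifs <;> omega
  · by_cases h2 : i + 3 ≤ M
    · refine ⟨c + i + 1, by omega, ?_⟩
      unfold extremalOffset
      split_ifs <;> omega
    -- Here `ω_j` has run out of room: its offset jumps from the linear profile to `M` at this
    -- position, one above the value `M - 1` allowed by the profile of `ω_i`.
    · refine ⟨c + M - 1, by omega, ?_⟩
      unfold extremalOffset
      split_ifs <;> omega

/-- Lexicographic optimality: lowering the offset of `ω_j` for the first time at `p`, with the last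
offset fixed, puts the whole sequence pointwise below some earlier `ω_i`, so the monomial is not
new. -/
theorem exists_le_extremalOffset {c j M p : ℕ} {o : ℕ → ℕ} (hM : 1 ≤ M)
    (ho : ∀ a b, a ≤ b → b < c + j + 3 → o a ≤ o b) (hlast : o (c + j + 2) = M)
    (hp : p < c + j + 3) (hlt : o p < extremalOffset c j M p)
    (heq : ∀ q < p, o q = extremalOffset c j M q) :
    ∃ i < j, ∀ M', M + 2 ≤ M' → ∀ q < c + i + 3, o q ≤ extremalOffset c i M' q := by
  have hub : ∀ q < c + j + 3, o q ≤ M := fun q hq => hlast ▸ ho q (c + j + 2) (by omega) (by omega)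
  have hprev : 1 ≤ p → extremalOffset c j M (p - 1) ≤ o p := fun h => by
    rw [← heq (p - 1) (by omega)]
    exact ho _ _ (by omega) hp
  have hpl : p ≠ c + j + 2 := by
    rintro rfl
    rw [extremalOffset_last] at hlt
    omega
  have hpM : o p < M := by
    have := extremalOffset_mono (c := c) (j := j) (M := M) (show p ≤ c + j + 2 by omega)
    rw [extremalOffset_last] at this
    omega
  by_cases hcase : o p + 1 = p - c ∧ p - c ≤ j
  -- The lowered value repeats the preceding value `p - c - 1` of the linear profile. For this `i`,
  -- the profile of `ω_i` has that value at `p = c + i + 1`, and only its larger last offset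
  -- follows.
  · refine ⟨p - c - 1, by omega, fun M' hM' q hq => ?_⟩
    rcases lt_trichotomy q p with hqp | rfl | hqp
    · have hqo := ho q p hqp.le hp
      rw [heq q hqp] at hqo ⊢
      clear hprev
      unfold extremalOffset at hqo ⊢
      split_ifs at hqo ⊢ <;> omega
    · unfold extremalOffset
      split_ifs <;> omega
    · have := hub q (by omega)
      unfold extremalOffset
      split_ifs <;> omega
  -- By monotonicity `o p` is at least the preceding offset. Before the last position the only
  -- increase exceeding one is the jump from `M - 2` to `M`, and `M - 1` is the one intermediate
  -- value left.
  · have h2 : M < j ∧ p + 1 = c + M ∧ o p + 1 = M := by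
      rcases Nat.eq_zero_or_pos p with rfl | hp0
      · unfold extremalOffset at hlt
        split_ifs at hlt <;> omega
      · have h3 := hprev hp0
        unfold extremalOffset at hlt h3
        split_ifs at hlt h3 <;> omega
    refine ⟨j - 1, by omega, fun M' hM' q hq => ?_⟩
    have hqM := hub q (by omega)
    rcases lt_trichotomy q p with hqp | rfl | hqp
    · rw [heq q hqp]
      unfold extremalOffset
      split_ifs <;> omega
    · unfold extremalOffset
      split_ifs <;> omega
    · unfold extremalOffset
      split_ifs <;> omega

/-- The monomial `ω_j`, of degree `c + j + 3`. -/
def extremalMonomial (n t c j : ℕ) : Finset (Fin n) :=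
  Finset.univ.filter fun x : Fin n => ∃ p < c + j + 3,
    p * t + extremalOffset c j (n - 1 - (c + j + 2) * t) p = x.val

variable {n t c : ℕ}

theorem enumerates_extremalMonomial (ht : 1 ≤ t) {j : ℕ} (hj : (c + j + 2) * t + 2 ≤ n) :
    Enumerates (fun p => p * t + extremalOffset c j (n - 1 - (c + j + 2) * t) p) (c + j + 3)
      (extremalMonomial n t c j) := by
  refine enumerates_filter ht (fun p q hpq _ => extremalOffset_mono hpq) fun p hp => ?_
  have h1 := extremalOffset_mono (c := c) (j := j) (M := n - 1 - (c + j + 2) * t)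
    (show p ≤ c + j + 2 by omega)
  rw [extremalOffset_last] at h1
  have h2 := Nat.mul_le_mul_right t (show p ≤ c + j + 2 by omega)
  omega

theorem isSpread_extremalMonomial (ht : 1 ≤ t) {j : ℕ} (hj : (c + j + 2) * t + 2 ≤ n) :
    IsSpread t (extremalMonomial n t c j) :=
  (enumerates_extremalMonomial ht hj).isSpread fun _ _ hpq _ => extremalOffset_mono hpq

theorem card_extremalMonomial (ht : 1 ≤ t) {j : ℕ} (hj : (c + j + 2) * t + 2 ≤ n) :
    (extremalMonomial n t c j).card = c + j + 3 :=
  (enumerates_extremalMonomial ht hj).card_eq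

theorem maxIndex_extremalMonomial (ht : 1 ≤ t) {j : ℕ} (hj : (c + j + 2) * t + 2 ≤ n) :
    maxIndex (extremalMonomial n t c j) = n := by
  rw [(enumerates_extremalMonomial ht hj).maxIndex_eq, extremalOffset_last]
  omega

theorem degree_bound_mono {i j : ℕ} (hij : i ≤ j) (hj : (c + j + 2) * t + 2 ≤ n) :
    (c + i + 2) * t + 2 ≤ n := by
  have := Nat.mul_le_mul_right t (show c + i + 2 ≤ c + j + 2 by omega)
  omega

theorem lastOffset_add_two_le (ht : 2 ≤ t) {i j : ℕ} (hij : i < j)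
    (hj : (c + j + 2) * t + 2 ≤ n) :
    n - 1 - (c + j + 2) * t + 2 ≤ n - 1 - (c + i + 2) * t := by
  have := Nat.mul_le_mul_right t (show c + i + 2 + 1 ≤ c + j + 2 by omega)
  rw [Nat.succ_mul] at this
  omega

theorem mem_newMonomials_iff {e : ℕ} {ω : ℕ → Finset (Fin n)} {j : ℕ} {u : Finset (Fin n)}
    (hω : ∀ i < j, IsSpread t (ω i) ∧ (ω i).card = e + i) :
    u ∈ newMonomials t e ω j ↔
      IsSpread t u ∧ u.card = e + j ∧ maxIndex u = n ∧ ∀ i < j, ¬ Dominates u (ω i) := by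
  constructor
  · rintro ⟨⟨hu, hcard⟩, hmax, hnew⟩
    refine ⟨hu, hcard, hmax, fun i hi hdom => hnew i hi ?_⟩
    obtain ⟨h1, h2⟩ := hω i hi
    exact (mem_iterate_spreadShadow_spreadBorel hu h1 (by omega)).2 hdom
  · rintro ⟨hu, hcard, hmax, hnew⟩
    refine ⟨⟨hu, hcard⟩, hmax, fun i hi hmem => hnew i hi ?_⟩
    obtain ⟨h1, h2⟩ := hω i hi
    exact (mem_iterate_spreadShadow_spreadBorel hu h1 (by omega)).1 hmem

/-- Newness means dominating no earlier `ω_i`. A competitor differing from `ω_j` is judged at the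
first differing offset: a smaller one destroys newness, a larger one makes it slex-smaller. -/
theorem isSlexMax_extremalMonomial (ht : 2 ≤ t) {j : ℕ} (hj : (c + j + 2) * t + 2 ≤ n) :
    IsSlexMax (newMonomials t (c + 3) (extremalMonomial n t c) j) (extremalMonomial n t c j) := by
  have ht1 : 1 ≤ t := by omega
  have hω : ∀ i < j, IsSpread t (extremalMonomial n t c i) ∧
      (extremalMonomial n t c i).card = c + 3 + i := fun i hi =>
    ⟨isSpread_extremalMonomial ht1 (degree_bound_mono hi.le hj),
      by rw [card_extremalMonomial ht1 (degree_bound_mono hi.le hj)]; omega⟩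
  have hE := fun i (hi : i ≤ j) => enumerates_extremalMonomial ht1 (degree_bound_mono hi hj)
  constructor
  · rw [mem_newMonomials_iff hω]
    refine ⟨isSpread_extremalMonomial ht1 hj, by rw [card_extremalMonomial ht1 hj]; omega,
      maxIndex_extremalMonomial ht1 hj, fun i hi hdom => ?_⟩
    obtain ⟨p, hp, hlt⟩ := exists_extremalOffset_lt (c := c)
      (M := n - 1 - (c + j + 2) * t) (by omega) hi (lastOffset_add_two_le ht hi hj)
    have := (((hE j le_rfl).dominates_iff (hE i hi.le)).1 hdom).2 p hp
    omega
  · intro v hv hne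
    obtain ⟨hvs, hvcard, hvmax, hvnew⟩ := (mem_newMonomials_iff hω).1 hv
    obtain ⟨o, ho, hov⟩ := hvs.exists_enumerates (e := c + j + 3) (by omega)
    have hlast : o (c + j + 2) = n - 1 - (c + j + 2) * t := by
      have := hov.maxIndex_eq
      omega
    have hex : ∃ p, p < c + j + 3 ∧ o p ≠ extremalOffset c j (n - 1 - (c + j + 2) * t) p := by
      by_contra! hcon
      exact hne (hov.eq_of_forall_eq (hE j le_rfl) fun q hq => by rw [hcon q hq])
    obtain ⟨hp, hpne⟩ := Nat.find_spec hex
    have hmin : ∀ q < Nat.find hex,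
        o q = extremalOffset c j (n - 1 - (c + j + 2) * t) q := fun q hq => by
      by_contra hcon
      exact Nat.find_min hex hq ⟨by omega, hcon⟩
    rcases lt_or_gt_of_ne hpne with hlt | hgt
    · exfalso
      obtain ⟨i, hi, hle⟩ := exists_le_extremalOffset (by omega) ho hlast hp hlt hmin
      refine hvnew i hi ((hov.dominates_iff (hE i hi.le)).2 ⟨by omega, fun q hq => ?_⟩)
      exact Nat.add_le_add_left (hle _ (lastOffset_add_two_le ht hi hj) q hq) _
    · exact (hE j le_rfl).slexGT hov hp (Nat.add_lt_add_left hgt _)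
        fun q hq => by rw [hmin q hq]

end ExtremalMonomials

/-! ### Corners of spread strongly stable ideals -/

section Corners

variable {K : Type*} [Field K] {n t : ℕ}

theorem IsSpreadStronglyStable.exists_of_gradedBetti_ne_zero (ht : 1 ≤ t)
    {I : Ideal (MvPolynomial (Fin n) K)} (hI : IsSpreadStronglyStable t I) {a l : ℕ}
    (h : gradedBetti I a (a + l) ≠ 0) :
    ∃ u ∈ minimalSupports I, u.card = l ∧ a ≤ (colonVariables t u).card := by
  rw [hI.1.eq_span_minimalSupports] at h
  exact (hI.hasLinearQuotients ht).exists_of_gradedBetti_ne_zero h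

theorem IsSpreadStronglyStable.gradedBetti_eq_one (ht : 1 ≤ t)
    {I : Ideal (MvPolynomial (Fin n) K)} (hI : IsSpreadStronglyStable t I) {a l : ℕ}
    {u : Finset (Fin n)} (hu : u ∈ minimalSupports I) (hl : u.card = l)
    (ha : (colonVariables t u).card = a)
    (hne : ∀ w ∈ minimalSupports I, w ≠ u → w.card = l → (colonVariables t w).card < a) :
    gradedBetti I a (a + l) = 1 := by
  conv_lhs => rw [hI.1.eq_span_minimalSupports]
  exact (hI.hasLinearQuotients ht).gradedBetti_eq_one hu hl ha hne

theorem isHomogeneous_sqfMonomial (u : Finset (Fin n)) :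
    (sqfMonomial K u).IsHomogeneous u.card := by
  rw [sqfMonomial_eq]
  exact isHomogeneous_monomial _ (indicator_one_degree u)

theorem sqfMonomial_ne_zero (u : Finset (Fin n)) : sqfMonomial K u ≠ 0 := by
  rw [sqfMonomial_eq]
  simp

theorem HasInitialDegree.le_card {I : Ideal (MvPolynomial (Fin n) K)} {e : ℕ}
    (h : HasInitialDegree I e) {u : Finset (Fin n)} (hu : u ∈ minimalSupports I) : e ≤ u.card :=
  h.2 ⟨_, (mem_minimalSupports.1 hu).1, sqfMonomial_ne_zero u, isHomogeneous_sqfMonomial u⟩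

theorem IsSpreadIdeal.hasInitialDegree {I : Ideal (MvPolynomial (Fin n) K)}
    (hI : IsSpreadIdeal t I) {u : Finset (Fin n)} (hu : u ∈ minimalSupports I)
    (hle : ∀ w ∈ minimalSupports I, u.card ≤ w.card) : HasInitialDegree I u.card := by
  refine ⟨⟨_, (mem_minimalSupports.1 hu).1, sqfMonomial_ne_zero u, isHomogeneous_sqfMonomial u⟩, ?_⟩
  rintro j ⟨f, hf, hf0, hfj⟩
  obtain ⟨m, hm⟩ := ne_zero_iff.1 hf0
  rw [hI.eq_span_minimalSupports] at hf
  obtain ⟨B, hB, hBm⟩ := mem_span_sqfMonomial_iff.1 hf m hm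
  refine (hle B hB).trans ?_
  have hdeg : m.degree = j := by
    rw [Finsupp.degree_eq_weight_one]
    exact hfj hm
  rw [← hdeg, Finsupp.degree_eq_sum, Finset.card_eq_sum_ones]
  exact (Finset.sum_le_sum fun i hi => Nat.one_le_iff_ne_zero.2 (hBm i hi)).trans
    (Finset.sum_le_sum_of_subset (Finset.subset_univ B))

/-- Of two corners in the same degree, the one with larger homological degree would have to vanish
by extremality of the other. -/
theorem injOn_snd_corners (I : Ideal (MvPolynomial (Fin n) K)) :
    Set.InjOn Prod.snd (corners I) := by
  rintro ⟨a, l⟩ ⟨h1, h2⟩ ⟨b, l'⟩ ⟨h3, h4⟩ hl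
  obtain rfl : l = l' := hl
  by_contra hne
  rcases le_total a b with hab | hab
  · exact h3 (h2 b l hab le_rfl (Ne.symm hne))
  · exact h1 (h4 a l hab le_rfl hne)

theorem finite_corners_of_snd_mem {I : Ideal (MvPolynomial (Fin n) K)} {e r : ℕ}
    (h : ∀ p ∈ corners I, e ≤ p.2 ∧ p.2 < e + r) :
    (corners I).Finite ∧ (corners I).ncard ≤ r := by
  have hsub : Prod.snd '' corners I ⊆ (Finset.Ico e (e + r) : Set ℕ) := by
    rintro _ ⟨p, hp, rfl⟩
    simpa using h p hp
  refine ⟨Set.Finite.of_finite_image ((Finset.finite_toSet _).subset hsub)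
    (injOn_snd_corners I), ?_⟩
  rw [← (injOn_snd_corners I).ncard_image]
  refine (Set.ncard_le_ncard hsub (Finset.finite_toSet _)).trans ?_
  rw [Set.ncard_coe_finset, Nat.card_Ico, Nat.add_sub_cancel_left]

/-- Excludes the top degree when `d = 1`, where the numerical estimate on `|V u|` alone still
permits degree `k + 1`. -/
theorem IsSpreadStronglyStable.corner_degree_lt (ht : 1 ≤ t)
    {I : Ideal (MvPolynomial (Fin n) K)} (hI : IsSpreadStronglyStable t I) {e T : ℕ}
    (he : 1 ≤ e) (hinit : HasInitialDegree I e) (hcorner : ∃ a, (a, e) ∈ corners I)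
    (hT : e ≤ T) (hn : n ≤ T * t + 1) {p : ℕ × ℕ} (hp : p ∈ corners I) : p.2 ≤ T := by
  obtain ⟨u, hu, hcard, -⟩ := hI.exists_of_gradedBetti_ne_zero ht hp.1
  obtain ⟨a, ha⟩ := hcorner
  obtain ⟨w, hw, hwcard, -⟩ := hI.exists_of_gradedBetti_ne_zero ht ha.1
  have hle := hinit.le_card hu
  by_contra! hcon
  have hform := card_colonVariables (hI.1.isSpread_of_mem_minimalSupports hu)
    (Finset.card_pos.1 (by omega))
  have h1 := Nat.mul_le_mul_left t (show T ≤ u.card - 1 by omega)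
  have h2 := maxIndex_le u
  have h3 : colonVariables t u = ∅ := by
    rw [← Finset.card_eq_zero]
    rw [mul_comm t T] at h1
    omega
  simp only at hwcard
  -- The corner in the initial degree supplies an earlier generator `w`, which must contain a colon
  -- variable of `u`; there are none.
  obtain ⟨x, hx, -⟩ := (hI.hasLinearQuotients ht).meets u hu w hw
    (by rintro rfl; omega) (degreeSlexKey_lt_iff.2 (Or.inl (by omega))).le
  simp [h3] at hx

theorem IsSpreadStronglyStable.corner_degree_mul_lt (ht : 1 ≤ t)
    {I : Ideal (MvPolynomial (Fin n) K)} (hI : IsSpreadStronglyStable t I) {e : ℕ}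
    (he : 1 ≤ e) (hinit : HasInitialDegree I e) {p : ℕ × ℕ} (hp : p ∈ corners I) :
    e ≤ p.2 ∧ (p.2 - 1) * t < n := by
  obtain ⟨u, hu, hcard, -⟩ := hI.exists_of_gradedBetti_ne_zero ht hp.1
  have hle := hinit.le_card hu
  have hform := card_colonVariables (hI.1.isSpread_of_mem_minimalSupports hu)
    (Finset.card_pos.1 (by omega))
  have h2 := maxIndex_le u
  rw [hcard, mul_comm] at hform
  exact ⟨by omega, by omega⟩

end Corners

/-! ### The ideal attaining the bound -/

section ExtremalIdeal

variable (K : Type*) [Field K] (n t c r : ℕ)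

/-- The ideal `B_t(ω_0, …, ω_{r-1})`. -/
noncomputable def extremalIdeal : Ideal (MvPolynomial (Fin n) K) :=
  spreadBorelIdeal K t (extremalMonomial n t c '' Set.Iio r)

variable {K n t c r}

theorem isSpreadStronglyStable_extremalIdeal (ht : 1 ≤ t)
    (hr : ∀ j < r, (c + j + 2) * t + 2 ≤ n) :
    IsSpreadStronglyStable t (extremalIdeal K n t c r) := by
  refine (isLeast_spreadBorelIdeal K t _ ?_).1.1
  rintro _ ⟨j, hj, rfl⟩
  exact isSpread_extremalMonomial ht (hr j hj)

theorem exists_dominates_of_mem_extremalIdeal (ht : 1 ≤ t)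
    (hr : ∀ j < r, (c + j + 2) * t + 2 ≤ n) {A : Finset (Fin n)}
    (hA : sqfMonomial K A ∈ extremalIdeal K n t c r) :
    ∃ B ⊆ A, sqfMonomial K B ∈ extremalIdeal K n t c r ∧ ∃ i < r, B.card = c + i + 3 ∧
      Dominates B (extremalMonomial n t c i) := by
  obtain ⟨B, hB, hBA⟩ := (sqfMonomial_mem_span K _ A).1 hA
  obtain ⟨_, ⟨i, hi, rfl⟩, hcard, hdom⟩ := SpreadBorel.exists_dominates hB
  exact ⟨B, hBA, Ideal.subset_span ⟨B, hB, rfl⟩, i, hi,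
    by rw [hcard, card_extremalMonomial ht (hr i hi)], hdom⟩

theorem exists_dominates_of_mem_minimalSupports (ht : 1 ≤ t)
    (hr : ∀ j < r, (c + j + 2) * t + 2 ≤ n) {u : Finset (Fin n)}
    (hu : u ∈ minimalSupports (extremalIdeal K n t c r)) :
    ∃ i < r, u.card = c + i + 3 ∧ Dominates u (extremalMonomial n t c i) := by
  obtain ⟨h1, h2⟩ := mem_minimalSupports.1 hu
  obtain ⟨B, hBu, hB, h⟩ := exists_dominates_of_mem_extremalIdeal ht hr h1
  rcases hBu.ssubset_or_eq with hlt | rfl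
  · exact absurd hB (h2 B hlt)
  · exact h

theorem not_dominates_extremalMonomial (ht : 2 ≤ t) {i j : ℕ} (hij : i < j)
    (hj : (c + j + 2) * t + 2 ≤ n) :
    ¬ Dominates (extremalMonomial n t c j) (extremalMonomial n t c i) := by
  refine ((mem_newMonomials_iff (e := c + 3) fun i' hi' => ?_).1
    (isSlexMax_extremalMonomial ht hj).1).2.2.2 i hij
  have hi := degree_bound_mono (t := t) (n := n) hi'.le hj
  exact ⟨isSpread_extremalMonomial (by omega) hi,
    by rw [card_extremalMonomial (by omega) hi]; omega⟩

theorem extremalMonomial_mem_minimalSupports (ht : 2 ≤ t)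
    (hr : ∀ j < r, (c + j + 2) * t + 2 ≤ n) {j : ℕ} (hj : j < r) :
    extremalMonomial n t c j ∈ minimalSupports (extremalIdeal K n t c r) := by
  have ht1 : 1 ≤ t := by omega
  refine mem_minimalSupports.2 ⟨Ideal.subset_span
    ⟨_, SpreadBorel.base _ ⟨j, hj, rfl⟩, rfl⟩, fun B hlt hB => ?_⟩
  obtain ⟨B', hsub, -, i, hi, hcard, hdom⟩ := exists_dominates_of_mem_extremalIdeal ht1 hr hB
  have h1 := Finset.card_lt_card (hsub.trans_ssubset hlt)
  rw [hcard, card_extremalMonomial ht1 (hr j hj)] at h1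
  exact not_dominates_extremalMonomial ht (show i < j by omega) (hr j hj)
    ((Dominates.of_subset (hsub.trans hlt.subset)).trans hdom)

/-- Such a `u` dominates `ω_j`, so it is slex-larger unless equal. Minimality prevents it from
dominating an earlier `ω_i`, so it competes in the maximum defining `ω_j`. -/
theorem eq_extremalMonomial_of_mem_minimalSupports (ht : 2 ≤ t)
    (hr : ∀ j < r, (c + j + 2) * t + 2 ≤ n) {j : ℕ} {u : Finset (Fin n)}
    (hu : u ∈ minimalSupports (extremalIdeal K n t c r)) (hcard : u.card = c + j + 3)
    (hmax : maxIndex u = n) : u = extremalMonomial n t c j := by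
  have ht1 : 1 ≤ t := by omega
  have hI := isSpreadStronglyStable_extremalIdeal (K := K) ht1 hr
  have hus := hI.1.isSpread_of_mem_minimalSupports hu
  obtain ⟨i, hi, hcard', hdom⟩ := exists_dominates_of_mem_minimalSupports ht1 hr hu
  obtain rfl : i = j := by omega
  have hω : ∀ i' < i, IsSpread t (extremalMonomial n t c i') ∧
      (extremalMonomial n t c i').card = c + 3 + i' := fun i' hi' =>
    ⟨isSpread_extremalMonomial ht1 (hr i' (by omega)),
      by rw [card_extremalMonomial ht1 (hr i' (by omega))]; omega⟩
  by_contra hne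
  refine (hdom.slexGT hne).asymm ((isSlexMax_extremalMonomial ht (hr i hi)).2 u
    ((mem_newMonomials_iff hω).2 ⟨hus, by omega, hmax, fun i' hi' hdom' => ?_⟩) hne)
  obtain ⟨w, hsub, hwcard, hwdom⟩ := hdom'.exists_subset
  have hwc : w.card = c + 3 + i' := by rw [hwcard, (hω i' hi').2]
  refine (mem_minimalSupports.1 hu).2 w (Finset.ssubset_iff_subset_ne.2 ⟨hsub, ?_⟩)
    (hI.mem_of_dominates (hω i' hi').1 (hus.subset hsub) hwdom
      (Ideal.subset_span ⟨_, SpreadBorel.base _ ⟨i', hi'.trans hi, rfl⟩, rfl⟩))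
  rintro rfl
  omega

theorem card_colonVariables_extremalMonomial (ht : 1 ≤ t) {j : ℕ}
    (hj : (c + j + 2) * t + 2 ≤ n) :
    (colonVariables t (extremalMonomial n t c j)).card = n - 1 - (c + j + 2) * t := by
  have hcard := card_extremalMonomial ht hj
  have h := card_colonVariables (isSpread_extremalMonomial ht hj)
    (Finset.card_pos.1 (by rw [hcard]; omega))
  rw [maxIndex_extremalMonomial ht hj, hcard, mul_comm] at h
  simp only [Nat.add_one_sub_one] at h
  omega

theorem gradedBetti_extremalIdeal (ht : 2 ≤ t) (hr : ∀ j < r, (c + j + 2) * t + 2 ≤ n) {j : ℕ}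
    (hj : j < r) :
    gradedBetti (extremalIdeal K n t c r) (n - 1 - (c + j + 2) * t)
      (n - 1 - (c + j + 2) * t + (c + j + 3)) = 1 := by
  have ht1 : 1 ≤ t := by omega
  have hI := isSpreadStronglyStable_extremalIdeal (K := K) ht1 hr
  refine hI.gradedBetti_eq_one ht1 (extremalMonomial_mem_minimalSupports ht hr hj)
    (card_extremalMonomial ht1 (hr j hj)) (card_colonVariables_extremalMonomial ht1 (hr j hj))
    fun w hw hne hcard => ?_
  have h1 := card_colonVariables (hI.1.isSpread_of_mem_minimalSupports hw)
    (Finset.card_pos.1 (by omega))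
  have h2 := maxIndex_le w
  have h3 : maxIndex w ≠ n := fun h =>
    hne (eq_extremalMonomial_of_mem_minimalSupports ht hr hw hcard h)
  rw [hcard, mul_comm] at h1
  simp only [Nat.add_one_sub_one] at h1
  omega

/-- Each nonzero Betti number in a generator degree `c + j + 3` lies at or to the left of the one
produced by `ω_j`, and these rightmost positions move strictly left as the degree increases. -/
theorem corners_extremalIdeal (ht : 2 ≤ t) (hr : ∀ j < r, (c + j + 2) * t + 2 ≤ n) :
    corners (extremalIdeal K n t c r) =
      (fun j => (n - 1 - (c + j + 2) * t, c + j + 3)) '' (Finset.range r : Set ℕ) := by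
  have ht1 : 1 ≤ t := by omega
  have hI := isSpreadStronglyStable_extremalIdeal (K := K) ht1 hr
  ext ⟨a, l⟩
  constructor
  · rintro ⟨h1, h2⟩
    simp only at h1 h2
    obtain ⟨u, hu, hcard, ha⟩ := hI.exists_of_gradedBetti_ne_zero ht1 h1
    obtain ⟨j, hj, hcard', -⟩ := exists_dominates_of_mem_minimalSupports ht1 hr hu
    have h3 := card_colonVariables (hI.1.isSpread_of_mem_minimalSupports hu)
      (Finset.card_pos.1 (by omega))
    have h4 := maxIndex_le u
    rw [hcard', mul_comm] at h3
    simp only [Nat.add_one_sub_one] at h3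
    refine ⟨j, by simpa using hj, ?_⟩
    by_contra hne
    have h5 := h2 (n - 1 - (c + j + 2) * t) (c + j + 3) (by omega) (by omega) hne
    rw [gradedBetti_extremalIdeal ht hr hj] at h5
    exact one_ne_zero h5
  · rintro ⟨j, hj, heq⟩
    have hj : j < r := by simpa using hj
    obtain ⟨rfl, rfl⟩ := Prod.mk.inj heq
    have hbound := hr j hj
    refine ⟨by rw [gradedBetti_extremalIdeal ht hr hj]; exact one_ne_zero, fun i l hi hl hne => ?_⟩
    by_contra hcon
    simp only at hi hl
    obtain ⟨u, hu, hcard, ha⟩ := hI.exists_of_gradedBetti_ne_zero ht1 hcon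
    have h3 := card_colonVariables (hI.1.isSpread_of_mem_minimalSupports hu)
      (Finset.card_pos.1 (by omega))
    have h4 := maxIndex_le u
    rw [hcard, mul_comm] at h3
    rcases hl.eq_or_lt with rfl | hlt
    · simp only [Nat.add_one_sub_one] at h3
      exact hne (by rw [Prod.mk.injEq]; exact ⟨by omega, rfl⟩)
    · have h5 := Nat.mul_le_mul_right t (show c + j + 2 + 1 ≤ l - 1 by omega)
      rw [Nat.succ_mul] at h5
      omega

theorem hasInitialDegree_extremalIdeal (ht : 2 ≤ t) (hr : ∀ j < r, (c + j + 2) * t + 2 ≤ n)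
    (hr0 : 0 < r) : HasInitialDegree (extremalIdeal K n t c r) (c + 3) := by
  have ht1 : 1 ≤ t := by omega
  have hcard := card_extremalMonomial (j := 0) ht1 (hr 0 hr0)
  have h := (isSpreadStronglyStable_extremalIdeal (K := K) ht1 hr).1.hasInitialDegree
    (extremalMonomial_mem_minimalSupports ht hr hr0) fun w hw => by
      obtain ⟨i, -, hi, -⟩ := exists_dominates_of_mem_minimalSupports ht1 hr hw
      omega
  rwa [hcard] at h

theorem mem_extremalMonomial_zero (hn : (c + 2) * t + 2 ≤ n) (i : Fin n) :
    i ∈ extremalMonomial n t c 0 ↔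
      (∃ a : ℕ, a + 2 ≤ c + 3 ∧ i.val + 1 = 1 + a * t) ∨ i.val + 1 = n := by
  rw [extremalMonomial, Finset.mem_filter]
  simp only [Finset.mem_univ, true_and, Nat.add_zero]
  constructor
  · rintro ⟨p, hp, hpi⟩
    by_cases hp2 : p < c + 2
    · refine Or.inl ⟨p, by omega, ?_⟩
      simp only [extremalOffset, Nat.zero_le, if_true, Nat.add_zero, if_pos hp2, Nat.min_zero] at hpi
      omega
    · obtain rfl : p = c + 2 := by omega
      have := extremalOffset_last c 0 (n - 1 - (c + 2) * t)
      simp only [Nat.add_zero] at this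
      omega
  · rintro (⟨a, ha, hai⟩ | hi)
    · refine ⟨a, by omega, ?_⟩
      simp only [extremalOffset, Nat.zero_le, if_true, Nat.add_zero,
        if_pos (show a < c + 2 by omega), Nat.min_zero]
      omega
    · refine ⟨c + 2, by omega, ?_⟩
      have := extremalOffset_last c 0 (n - 1 - (c + 2) * t)
      simp only [Nat.add_zero] at this
      omega

end ExtremalIdeal

/-! ### Numerical range and the main theorem -/

theorem floor_sub_two_div {d t : ℕ} (hd : 1 ≤ d) (hdt : d ≤ t) :
    (d = 1 ∧ ⌊((d : ℚ) - 2) / t⌋ = -1) ∨ (2 ≤ d ∧ ⌊((d : ℚ) - 2) / t⌋ = 0) := by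
  have ht : (1 : ℚ) ≤ t := by exact_mod_cast hd.trans hdt
  have ht0 : (0 : ℚ) < t := by linarith
  rcases hd.eq_or_lt with rfl | hd
  · refine Or.inl ⟨rfl, Int.floor_eq_iff.2 ⟨?_, ?_⟩⟩
    · rw [le_div_iff₀ ht0]
      push_cast
      linarith
    · rw [div_lt_iff₀ ht0]
      push_cast
      linarith
  · have hd2 : (2 : ℚ) ≤ d := by exact_mod_cast hd
    have hdt' : (d : ℚ) ≤ t := by exact_mod_cast hdt
    refine Or.inr ⟨hd, Int.floor_eq_iff.2 ⟨?_, ?_⟩⟩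
    · rw [le_div_iff₀ ht0]
      push_cast
      linarith
    · rw [div_lt_iff₀ ht0]
      push_cast
      linarith

theorem mainTheorem2 {K : Type*} [Field K] (n t d k ℓ₁ : ℕ) (ht : 2 ≤ t) (hk : 3 ≤ k)
    (hd : 1 ≤ d) (hdt : d ≤ t) (hn : n = d + k * t) (hℓ : 3 ≤ ℓ₁)
    (hℓk : (ℓ₁ : ℤ) ≤ k + ⌊((d : ℚ) - 2) / t⌋ + 1) :
    ∃ r : ℕ, (r : ℤ) = k + ⌊((d : ℚ) - 2) / t⌋ - ((ℓ₁ : ℤ) - 2) ∧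
      -- the bound
      (∀ I ∈ spreadStableOne K n t, HasInitialDegree I ℓ₁ → (∃ k₁, (k₁, ℓ₁) ∈ corners I) →
        (corners I).Finite ∧ (corners I).ncard ≤ r) ∧
      -- an explicit ideal `B_t(ω_0, …, ω_{r-1})` attaining it
      ∃ ω : ℕ → Finset (Fin n),
        (∀ i : Fin n, i ∈ ω 0 ↔
          (∃ a : ℕ, a + 2 ≤ ℓ₁ ∧ i.val + 1 = 1 + a * t) ∨ i.val + 1 = n) ∧
        (∀ j, 1 ≤ j → j < r → IsSlexMax (newMonomials t ℓ₁ ω j) (ω j)) ∧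
        spreadBorelIdeal K t (ω '' Set.Iio r) ∈ spreadStableOne K n t ∧
        HasInitialDegree (spreadBorelIdeal K t (ω '' Set.Iio r)) ℓ₁ ∧
        (∃ k₁, (k₁, ℓ₁) ∈ corners (spreadBorelIdeal K t (ω '' Set.Iio r))) ∧
        (corners (spreadBorelIdeal K t (ω '' Set.Iio r))).Finite ∧
        (corners (spreadBorelIdeal K t (ω '' Set.Iio r))).ncard = r := by
  have ht1 : 1 ≤ t := by omega
  obtain ⟨c, rfl⟩ := Nat.exists_eq_add_of_le' hℓ
  -- The floor is `-1` for `d = 1` and `0` otherwise. In both cases every `ω_j` with `j < r` keeps a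
  -- last offset of at least `1`, which is the content of `(c + j + 2) * t + 2 ≤ n`.
  obtain ⟨r, hr0, hrZ, hrT, hrn⟩ : ∃ r : ℕ, 0 < r ∧
      (r : ℤ) = k + ⌊((d : ℚ) - 2) / t⌋ - (((c + 3 : ℕ) : ℤ) - 2) ∧
      ((d = 1 ∧ c + 2 + r = k) ∨ (2 ≤ d ∧ c + 1 + r = k)) ∧
      ∀ j < r, (c + j + 2) * t + 2 ≤ n := by
    rcases floor_sub_two_div hd hdt with ⟨rfl, hfl⟩ | ⟨hd2, hfl⟩
    · rw [hfl] at hℓk ⊢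
      refine ⟨k - c - 2, by omega, by omega, by omega, fun j hj => ?_⟩
      have := Nat.mul_le_mul_right t (show c + j + 2 + 1 ≤ k by omega)
      rw [Nat.succ_mul] at this
      omega
    · rw [hfl] at hℓk ⊢
      refine ⟨k - c - 1, by omega, by omega, by omega, fun j hj => ?_⟩
      have := Nat.mul_le_mul_right t (show c + j + 2 ≤ k by omega)
      omega
  have hcorners := corners_extremalIdeal (K := K) ht hrn
  refine ⟨r, hrZ, ?_, extremalMonomial n t c, mem_extremalMonomial_zero (hrn 0 hr0),
    fun j _ hj => isSlexMax_extremalMonomial ht (hrn j hj),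
    ⟨isSpreadStronglyStable_extremalIdeal ht1 hrn, ?_⟩, hasInitialDegree_extremalIdeal ht hrn hr0,
    ⟨n - 1 - (c + 0 + 2) * t, ?_⟩, ?_, ?_⟩
  · intro I hI hinit hcorner
    refine finite_corners_of_snd_mem (e := c + 3) fun p hp => ?_
    obtain ⟨h1, h2⟩ := hI.1.corner_degree_mul_lt ht1 (by omega) hinit hp
    refine ⟨h1, ?_⟩
    -- The corner degrees lie in `[ℓ₁, k]` for `d = 1` and in `[ℓ₁, k + 1]` for `d ≥ 2`; either
    -- interval has `r` elements.
    rcases hrT with ⟨rfl, hk'⟩ | ⟨hd2, hk'⟩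
    · have := hI.1.corner_degree_lt ht1 (by omega) hinit hcorner (T := k) (by omega) (by omega) hp
      omega
    · have h3 : p.2 - 1 < k + 1 := by
        by_contra! hcon
        have := Nat.mul_le_mul_right t hcon
        rw [Nat.succ_mul] at this
        omega
      omega
  · intro p hp
    obtain ⟨j, hj, rfl⟩ := hcorners.subset hp
    exact gradedBetti_extremalIdeal ht hrn (by simpa using hj)
  · exact hcorners.superset ⟨0, by simpa using hr0, by simp⟩
  · exact (Set.Finite.image _ (Finset.finite_toSet _)).subset hcorners.subset
  · have : (corners (extremalIdeal K n t c r)).ncard = r := by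
      rw [hcorners, Set.ncard_image_of_injective, Set.ncard_coe_finset, Finset.card_range]
      intro a b hab
      have := (Prod.mk.inj hab).2
      omega
    exact this
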